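/- Throughout, $\otimes$ between C*-algebras is the spatial (minimal) tensor product. Let $G=(\mathcal A,\Delta)$ be a compact quantum group: $\mathcal A$ is a unital C*-algebra and $\Delta:\mathcal A\to\mathcal A\otimes\mathcal A$ is a unital $*$-homomorphism with $(\Delta\otimes\iota)\Delta=(\iota\otimes\Delta)\Delta$ such that $\{(b\otimes I)\Delta(c): b,c\in\mathcal A\}$ and $\{(I\otimes b)\Delta(c): b,c\in\mathcal A\}$ both span dense subspaces of $\mathcal A\otimes\mathcal A$. Let $h$ be its Haar state, i.e. the state with $(\iota\otimes h)\Delta(a)=h(a)I=(h\otimes\iota)\Delta(a)$ for all $a\in\mathcal A$. Let $\delta:\mathcal C\to\mathcal C\otimes\mathcal A$ be an action of $G$ on a unital C*-algebra $\mathcal C$, i.e. a unital $*$-homomorphism with $(\delta\otimes\iota)\delta=(\iota\otimes\Delta)\delta$, such that the linear span of $(I\otimes\mathcal A)\,\delta(\mathcal C)$ is dense in $\mathcal C\otimes\mathcal A$. Write $\mathcal C^\delta=\{c\in\mathcal C:\delta(c)=c\otimes I\}$, call a closed left ideal or a C*-subalgebra $\mathcal B$ of $\mathcal C$ *$G$-invariant*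 if $\delta(\mathcal B)\subseteq\mathcal B\otimes\mathcal A$ (the closed linear span of the elements $b\otimes a$, $b\in\mathcal B$, $a\in\mathcal A$), and call a left ideal, a C*-subalgebra or a projection *proper* if it is neither zero nor everything (the whole algebra, respectively the unit). Let $\mathcal C''\cong\mathcal C^{**}$ be the enveloping von Neumann algebra of $\mathcal C$. A projection of $\mathcal C''$ is *open* if it is the limit of an increasing net of positive elements of $\mathcal C$. Let $\delta'':\mathcal C''\to(\mathcal C\otimes\mathcal A)''$ be the normal extension of $\delta$, and for $p\in\mathcal C''$ let $p\otimes I\in(\mathcal C\otimes\mathcal A)''$ be the image of $p$ under the normal extension of $c\mapsto c\otimes I$. **Theorem.** Suppose that the Haar state is faithful ($h(a^*a)=0$ implies $a=0$) and that $\delta$ is faithful (injective). Then the following conditions are equivalent: (a) $\mathcal C^\delta=\mathbb C I$ (the action is ergodic); (b') there is no proper closed $G$-invariant left ideal of $\mathcal C$; (c') there is no proper hereditary $G$-invariant C*-subalgebra of $\mathcal C$; (d') there is no proper open projection $p\in\mathcal C''$ such that $\delta''(p)\le p\otimes I$. -/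

import Mathlib

open scoped TensorProduct ComplexOrder
open UniformSpace

universe u

noncomputable section

/-- The Hilbert space tensor product. -/
def HilbertTensor (H K : Type u) [NormedAddCommGroup H] [InnerProductSpace ℂ H]
    [NormedAddCommGroup K] [InnerProductSpace ℂ K] : Type u := Completion (H ⊗[ℂ] K)

namespace HilbertTensor

variable {H K : Type u} [NormedAddCommGroup H] [InnerProductSpace ℂ H]
  [NormedAddCommGroup K] [InnerProductSpace ℂ K]

instance : NormedAddCommGroup (HilbertTensor H K) :=
  inferInstanceAs (NormedAddCommGroup (Completion (H ⊗[ℂ] K)))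
instance : InnerProductSpace ℂ (HilbertTensor H K) :=
  inferInstanceAs (InnerProductSpace ℂ (Completion (H ⊗[ℂ] K)))
instance : CompleteSpace (HilbertTensor H K) :=
  inferInstanceAs (CompleteSpace (Completion (H ⊗[ℂ] K)))

/-- The canonical map of the algebraic tensor product into its completion. -/
def incl : H ⊗[ℂ] K →ₗ[ℂ] HilbertTensor H K where
  toFun x := ((x : H ⊗[ℂ] K) : Completion (H ⊗[ℂ] K))
  map_add' x y := Completion.coe_add x y
  map_smul' r x := Completion.coe_smul r x

theorem denseRange_incl : DenseRange (incl : H ⊗[ℂ] K → HilbertTensor H K) :=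
  Completion.denseRange_coe

theorem inner_incl (x y : H ⊗[ℂ] K) : inner ℂ (incl x) (incl y) = inner ℂ x y :=
  Completion.inner_coe x y

theorem ext_clm {X Y : HilbertTensor H K →L[ℂ] HilbertTensor H K}
    (h : ∀ x : H ⊗[ℂ] K, X (incl x) = Y (incl x)) : X = Y :=
  DFunLike.coe_injective (denseRange_incl.equalizer X.continuous Y.continuous (funext h))

/-- The operator `S ⊗ T` on the Hilbert space tensor product. -/
def op (S : H →L[ℂ] H) (T : K →L[ℂ] K) : HilbertTensor H K →L[ℂ] HilbertTensor H K :=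
  show Completion (H ⊗[ℂ] K) →L[ℂ] Completion (H ⊗[ℂ] K) from
    (TensorProduct.mapL S T).completion

theorem op_incl (S : H →L[ℂ] H) (T : K →L[ℂ] K) (x : H ⊗[ℂ] K) :
    op S T (incl x) = incl (TensorProduct.map S.toLinearMap T.toLinearMap x) :=
  ((TensorProduct.mapL S T).completion_apply_coe x).trans
    (congrArg _ (TensorProduct.mapL_apply S T x))

theorem op_one : op (1 : H →L[ℂ] H) (1 : K →L[ℂ] K) = 1 :=
  ext_clm fun x => by
    rw [op_incl]
    exact congrArg _ (DFunLike.congr_fun TensorProduct.map_id x)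

theorem op_add_left (S₁ S₂ : H →L[ℂ] H) (T : K →L[ℂ] K) :
    op (S₁ + S₂) T = op S₁ T + op S₂ T :=
  ext_clm fun x => by
    change _ = op S₁ T (incl x) + op S₂ T (incl x)
    rw [op_incl, op_incl, op_incl, ← map_add]
    exact congrArg _ (DFunLike.congr_fun
      (TensorProduct.map_add_left S₁.toLinearMap S₂.toLinearMap T.toLinearMap) x)

theorem op_add_right (S : H →L[ℂ] H) (T₁ T₂ : K →L[ℂ] K) :
    op S (T₁ + T₂) = op S T₁ + op S T₂ :=
  ext_clm fun x => by
    change _ = op S T₁ (incl x) + op S T₂ (incl x)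
    rw [op_incl, op_incl, op_incl, ← map_add]
    exact congrArg _ (DFunLike.congr_fun
      (TensorProduct.map_add_right S.toLinearMap T₁.toLinearMap T₂.toLinearMap) x)

theorem op_smul_left (r : ℂ) (S : H →L[ℂ] H) (T : K →L[ℂ] K) :
    op (r • S) T = r • op S T :=
  ext_clm fun x => by
    change _ = r • op S T (incl x)
    rw [op_incl, op_incl, ← map_smul]
    exact congrArg _ (DFunLike.congr_fun
      (TensorProduct.map_smul_left r S.toLinearMap T.toLinearMap) x)

theorem op_smul_right (r : ℂ) (S : H →L[ℂ] H) (T : K →L[ℂ] K) :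
    op S (r • T) = r • op S T :=
  ext_clm fun x => by
    change _ = r • op S T (incl x)
    rw [op_incl, op_incl, ← map_smul]
    exact congrArg _ (DFunLike.congr_fun
      (TensorProduct.map_smul_right r S.toLinearMap T.toLinearMap) x)

theorem op_mul (S₁ S₂ : H →L[ℂ] H) (T₁ T₂ : K →L[ℂ] K) :
    op (S₁ * S₂) (T₁ * T₂) = op S₁ T₁ * op S₂ T₂ :=
  ext_clm fun x => by
    change _ = op S₁ T₁ (op S₂ T₂ (incl x))
    have h1 : (S₁ * S₂).toLinearMap = S₁.toLinearMap ∘ₗ S₂.toLinearMap := rfl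
    have h2 : (T₁ * T₂).toLinearMap = T₁.toLinearMap ∘ₗ T₂.toLinearMap := rfl
    rw [op_incl, op_incl, op_incl, h1, h2, TensorProduct.map_comp, LinearMap.comp_apply]

theorem op_star [CompleteSpace H] [CompleteSpace K] (S : H →L[ℂ] H) (T : K →L[ℂ] K) :
    star (op S T) = op (star S) (star T) := by
  rw [ContinuousLinearMap.star_eq_adjoint, eq_comm, ContinuousLinearMap.eq_adjoint_iff]
  intro x y
  refine denseRange_incl.induction_on₂ (isClosed_eq (by fun_prop) (by fun_prop)) (fun x y => ?_) x y
  rw [op_incl, op_incl, inner_incl, inner_incl]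
  induction x with
  | zero => simp
  | add x₁ x₂ h₁ h₂ => simp only [map_add, inner_add_left, h₁, h₂]
  | tmul x₁ x₂ =>
    induction y with
    | zero => simp
    | add y₁ y₂ h₁ h₂ => simp only [map_add, inner_add_right, h₁, h₂]
    | tmul y₁ y₂ =>
      simp only [TensorProduct.map_tmul, TensorProduct.inner_tmul, ContinuousLinearMap.coe_coe,
        ContinuousLinearMap.star_eq_adjoint, ContinuousLinearMap.adjoint_inner_left]

end HilbertTensor

/-- A unital `*`-representation of a unital C*-algebra on a Hilbert space. -/
structure HilbertRep (A : Type u) [CStarAlgebra A] where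
  H : Type u
  [instNormed : NormedAddCommGroup H]
  [instInner : InnerProductSpace ℂ H]
  [instComplete : CompleteSpace H]
  toHom : A →⋆ₐ[ℂ] (H →L[ℂ] H)

attribute [instance] HilbertRep.instNormed HilbertRep.instInner HilbertRep.instComplete

namespace HilbertRep

variable {A A' B B' : Type u} [CStarAlgebra A] [CStarAlgebra A'] [CStarAlgebra B] [CStarAlgebra B']

/-- Pull-back of a representation along a unital `*`-homomorphism. -/
def comap (π : HilbertRep A') (f : A →⋆ₐ[ℂ] A') : HilbertRep A where
  H := π.H
  toHom := π.toHom.comp f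

theorem norm_toHom_le (π : HilbertRep A) (a : A) : ‖π.toHom a‖ ≤ ‖a‖ :=
  NonUnitalStarAlgHom.norm_apply_le π.toHom a

/-- The representation `a ⊗ b ↦ π a ⊗ ρ b` of the algebraic tensor product on the Hilbert space
tensor product. -/
def tensor (π : HilbertRep A) (ρ : HilbertRep B) :
    A ⊗[ℂ] B →ₐ[ℂ] (HilbertTensor π.H ρ.H →L[ℂ] HilbertTensor π.H ρ.H) :=
  Algebra.TensorProduct.lift
    (AlgHom.ofLinearMap
      { toFun := fun a => HilbertTensor.op (π.toHom a) (1 : ρ.H →L[ℂ] ρ.H)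
        map_add' := fun a b => by rw [map_add, HilbertTensor.op_add_left]
        map_smul' := fun r a => by rw [map_smul, HilbertTensor.op_smul_left]; rfl }
      (by
        change HilbertTensor.op (π.toHom 1) (1 : ρ.H →L[ℂ] ρ.H) = 1
        rw [map_one, HilbertTensor.op_one])
      (fun a b => by
        change HilbertTensor.op (π.toHom (a * b)) (1 : ρ.H →L[ℂ] ρ.H) =
          HilbertTensor.op (π.toHom a) 1 * HilbertTensor.op (π.toHom b) 1
        rw [← HilbertTensor.op_mul, map_mul, one_mul]))
    (AlgHom.ofLinearMap
      { toFun := fun b => HilbertTensor.op (1 : π.H →L[ℂ] π.H) (ρ.toHom b)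
        map_add' := fun a b => by rw [map_add, HilbertTensor.op_add_right]
        map_smul' := fun r a => by rw [map_smul, HilbertTensor.op_smul_right]; rfl }
      (by
        change HilbertTensor.op (1 : π.H →L[ℂ] π.H) (ρ.toHom 1) = 1
        rw [map_one, HilbertTensor.op_one])
      (fun a b => by
        change HilbertTensor.op (1 : π.H →L[ℂ] π.H) (ρ.toHom (a * b)) =
          HilbertTensor.op 1 (ρ.toHom a) * HilbertTensor.op 1 (ρ.toHom b)
        rw [← HilbertTensor.op_mul, map_mul, one_mul]))
    (fun a b => by
      change HilbertTensor.op (π.toHom a) 1 * HilbertTensor.op 1 (ρ.toHom b) =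
        HilbertTensor.op 1 (ρ.toHom b) * HilbertTensor.op (π.toHom a) 1
      rw [← HilbertTensor.op_mul, ← HilbertTensor.op_mul, one_mul, mul_one, one_mul, mul_one])

theorem tensor_tmul (π : HilbertRep A) (ρ : HilbertRep B) (a : A) (b : B) :
    π.tensor ρ (a ⊗ₜ b) = HilbertTensor.op (π.toHom a) (ρ.toHom b) := by
  change HilbertTensor.op (π.toHom a) 1 * HilbertTensor.op 1 (ρ.toHom b) = _
  rw [← HilbertTensor.op_mul, one_mul, mul_one]

theorem tensor_comap (π : HilbertRep A') (ρ : HilbertRep B') (f : A →⋆ₐ[ℂ] A') (g : B →⋆ₐ[ℂ] B')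
    (t : A ⊗[ℂ] B) :
    (π.comap f).tensor (ρ.comap g) t =
      π.tensor ρ (Algebra.TensorProduct.map f.toAlgHom g.toAlgHom t) := by
  induction t with
  | zero => rw [map_zero, map_zero, map_zero]; rfl
  | add x y hx hy => rw [map_add, map_add, map_add, hx, hy]; rfl
  | tmul a b => rw [Algebra.TensorProduct.map_tmul, tensor_tmul, tensor_tmul]; rfl

theorem tensor_star (π : HilbertRep A) (ρ : HilbertRep B) (t : A ⊗[ℂ] B) :
    π.tensor ρ (star t) = star (π.tensor ρ t) := by
  induction t with
  | zero => rw [star_zero, map_zero, star_zero]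
  | add s t hs ht => rw [star_add, map_add, map_add, star_add, hs, ht]
  | tmul a b => rw [TensorProduct.star_tmul, tensor_tmul, tensor_tmul, HilbertTensor.op_star, map_star,
      map_star]

theorem exists_norm_tensor_le (t : A ⊗[ℂ] B) :
    ∃ M : ℝ, 0 ≤ M ∧ ∀ (π : HilbertRep A) (ρ : HilbertRep B), ‖π.tensor ρ t‖ ≤ M := by
  induction t with
  | zero => exact ⟨0, le_rfl, fun π ρ => by rw [map_zero, norm_zero]⟩
  | add s t hs ht =>
    obtain ⟨M, hM, h⟩ := hs
    obtain ⟨N, hN, h'⟩ := ht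
    refine ⟨M + N, add_nonneg hM hN, fun π ρ => ?_⟩
    rw [map_add]
    exact (norm_add_le _ _).trans (add_le_add (h π ρ) (h' π ρ))
  | tmul a b =>
    refine ⟨‖a‖ * ‖b‖, by positivity, fun π ρ => ?_⟩
    rw [← mul_one a, ← one_mul b, ← Algebra.TensorProduct.tmul_mul_tmul, map_mul, mul_one, one_mul]
    have h1 : ‖π.tensor ρ (a ⊗ₜ 1)‖ ≤ ‖a‖ := NonUnitalStarAlgHom.norm_apply_le
      ({ (π.tensor ρ).comp Algebra.TensorProduct.includeLeft with
          map_star' := fun a => by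
            change π.tensor ρ (star a ⊗ₜ 1) = star (π.tensor ρ (a ⊗ₜ 1))
            rw [← tensor_star, TensorProduct.star_tmul, star_one] } : A →⋆ₐ[ℂ] _) a
    have h2 : ‖π.tensor ρ (1 ⊗ₜ b)‖ ≤ ‖b‖ := NonUnitalStarAlgHom.norm_apply_le
      ({ (π.tensor ρ).comp Algebra.TensorProduct.includeRight with
          map_star' := fun a => by
            change π.tensor ρ (1 ⊗ₜ star a) = star (π.tensor ρ (1 ⊗ₜ a))
            rw [← tensor_star, TensorProduct.star_tmul, star_one] } : B →⋆ₐ[ℂ] _) b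
    exact (norm_mul_le _ _).trans (mul_le_mul h1 h2 (norm_nonneg _) (norm_nonneg _))

theorem sq_norm_tensor_le (π : HilbertRep A) (ρ : HilbertRep B) (t : A ⊗[ℂ] B) :
    ‖π.tensor ρ t‖ ^ 2 ≤ ‖π.tensor ρ (star t * t)‖ := by
  rw [map_mul, tensor_star, CStarRing.norm_star_mul_self, sq]

end HilbertRep

section Spatial

variable (A A' B B' : Type u) [CStarAlgebra A] [CStarAlgebra A'] [CStarAlgebra B]
  [CStarAlgebra B']

/-- The algebraic tensor product of two C*-algebras, to be equipped with the spatial norm. -/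
def PreSpatial : Type u := A ⊗[ℂ] B

namespace PreSpatial

instance : Ring (PreSpatial A B) := inferInstanceAs (Ring (A ⊗[ℂ] B))
instance : Algebra ℂ (PreSpatial A B) := inferInstanceAs (Algebra ℂ (A ⊗[ℂ] B))
instance : StarAddMonoid (PreSpatial A B) := inferInstanceAs (StarAddMonoid (A ⊗[ℂ] B))
instance : StarModule ℂ (PreSpatial A B) := inferInstanceAs (StarModule ℂ (A ⊗[ℂ] B))

variable {A A' B B'}

theorem star_mul_aux (s t : A ⊗[ℂ] B) : star (s * t) = star t * star s := by
  induction s with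
  | zero => simp
  | add x y hx hy => rw [add_mul, star_add, hx, hy, star_add, mul_add]
  | tmul a b =>
    induction t with
    | zero => simp
    | add x y hx hy => rw [mul_add, star_add, hx, hy, star_add, add_mul]
    | tmul c d => simp [Algebra.TensorProduct.tmul_mul_tmul]

instance : StarRing (PreSpatial A B) where
  star_mul := star_mul_aux
  star_add := star_add

/-- The spatial (minimal) C*-norm of the algebraic tensor product: the supremum of the operator
norms in the tensor products of all pairs of representations. -/
def spatialNorm (t : A ⊗[ℂ] B) : ℝ :=
  ⨆ p : HilbertRep A × HilbertRep B, ‖p.1.tensor p.2 t‖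

theorem bddAbove (t : A ⊗[ℂ] B) : BddAbove
    (Set.range fun p : HilbertRep A × HilbertRep B => ‖p.1.tensor p.2 t‖) := by
  obtain ⟨M, -, h⟩ := HilbertRep.exists_norm_tensor_le t
  exact ⟨M, by rintro _ ⟨p, rfl⟩; exact h p.1 p.2⟩

theorem norm_tensor_le (π : HilbertRep A) (ρ : HilbertRep B) (t : A ⊗[ℂ] B) :
    ‖π.tensor ρ t‖ ≤ spatialNorm t :=
  le_ciSup (bddAbove t) (⟨π, ρ⟩ : HilbertRep A × HilbertRep B)

theorem spatialNorm_nonneg (t : A ⊗[ℂ] B) : 0 ≤ spatialNorm t :=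
  Real.iSup_nonneg fun _ => norm_nonneg _

theorem spatialNorm_le {t : A ⊗[ℂ] B} {M : ℝ} (hM : 0 ≤ M)
    (h : ∀ (π : HilbertRep A) (ρ : HilbertRep B), ‖π.tensor ρ t‖ ≤ M) : spatialNorm t ≤ M :=
  Real.iSup_le (fun p => h p.1 p.2) hM

theorem spatialNorm_add_le (s t : A ⊗[ℂ] B) :
    spatialNorm (s + t) ≤ spatialNorm s + spatialNorm t :=
  spatialNorm_le (add_nonneg (spatialNorm_nonneg s) (spatialNorm_nonneg t)) fun π ρ => by
    rw [map_add]
    exact (norm_add_le _ _).trans (add_le_add (norm_tensor_le π ρ s) (norm_tensor_le π ρ t))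

theorem spatialNorm_mul_le (s t : A ⊗[ℂ] B) :
    spatialNorm (s * t) ≤ spatialNorm s * spatialNorm t :=
  spatialNorm_le (mul_nonneg (spatialNorm_nonneg s) (spatialNorm_nonneg t)) fun π ρ => by
    rw [map_mul]
    exact (norm_mul_le _ _).trans (mul_le_mul (norm_tensor_le π ρ s) (norm_tensor_le π ρ t)
      (norm_nonneg _) (spatialNorm_nonneg s))

theorem spatialNorm_smul_le (r : ℂ) (t : A ⊗[ℂ] B) :
    spatialNorm (r • t) ≤ ‖r‖ * spatialNorm t :=
  spatialNorm_le (mul_nonneg (norm_nonneg r) (spatialNorm_nonneg t)) fun π ρ => by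
    rw [map_smul, norm_smul]
    exact mul_le_mul_of_nonneg_left (norm_tensor_le π ρ t) (norm_nonneg r)

theorem spatialNorm_sq_le (t : A ⊗[ℂ] B) :
    spatialNorm t * spatialNorm t ≤ spatialNorm (star t * t) := by
  have h : spatialNorm t ≤ Real.sqrt (spatialNorm (star t * t)) :=
    spatialNorm_le (Real.sqrt_nonneg _) fun π ρ =>
      Real.le_sqrt_of_sq_le ((HilbertRep.sq_norm_tensor_le π ρ t).trans (norm_tensor_le π ρ _))
  calc _ ≤ Real.sqrt (spatialNorm (star t * t)) * Real.sqrt (spatialNorm (star t * t)) :=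
        mul_le_mul h h (spatialNorm_nonneg t) (Real.sqrt_nonneg _)
    _ = _ := Real.mul_self_sqrt (spatialNorm_nonneg _)

theorem spatialNorm_star_le (t : A ⊗[ℂ] B) : spatialNorm (star t) ≤ spatialNorm t := by
  have h := spatialNorm_sq_le (star t)
  have h' := spatialNorm_mul_le t (star t)
  rw [star_star] at h
  by_contra! hlt
  have := (spatialNorm_nonneg t).trans_lt hlt
  nlinarith

instance : SeminormedAddCommGroup (PreSpatial A B) :=
  AddGroupSeminorm.toSeminormedAddCommGroup
    { toFun := (spatialNorm : A ⊗[ℂ] B → ℝ)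
      map_zero' := le_antisymm (spatialNorm_le (t := (0 : A ⊗[ℂ] B)) le_rfl fun π ρ => by
          rw [map_zero, norm_zero])
        (spatialNorm_nonneg _)
      add_le' := spatialNorm_add_le
      neg' := fun t => by
        have h (s : A ⊗[ℂ] B) : spatialNorm (-s) ≤ spatialNorm s := by
          simpa using spatialNorm_smul_le (-1) s
        exact le_antisymm (h t) ((congrArg spatialNorm (neg_neg (G := A ⊗[ℂ] B) t).symm).trans_le
          (h (-t : A ⊗[ℂ] B))) }

theorem norm_def (t : PreSpatial A B) : ‖t‖ = spatialNorm (A := A) (B := B) t := rfl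

instance : SeminormedRing (PreSpatial A B) where
  __ := (inferInstance : Ring (PreSpatial A B))
  __ := (inferInstance : SeminormedAddCommGroup (PreSpatial A B))
  norm_mul_le := spatialNorm_mul_le

instance : NormedAlgebra ℂ (PreSpatial A B) where
  norm_smul_le := spatialNorm_smul_le

instance : NormedStarGroup (PreSpatial A B) where
  norm_star_le := spatialNorm_star_le

end PreSpatial

/-- The spatial (minimal) tensor product of two unital C*-algebras. -/
abbrev SpatialTensor : Type u := Completion (PreSpatial A B)

namespace SpatialTensor

variable {A A' B B'}

theorem star_uc : UniformContinuous (star : PreSpatial A B → PreSpatial A B) :=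
  star_isometry.uniformContinuous

instance : Star (SpatialTensor A B) := ⟨Completion.map star⟩

theorem coe_star (x : PreSpatial A B) : ((star x : PreSpatial A B) : SpatialTensor A B) = star (x : SpatialTensor A B) :=
  (Completion.map_coe star_uc x).symm

theorem continuous_star' : Continuous (star : SpatialTensor A B → SpatialTensor A B) :=
  Completion.continuous_map

instance : StarRing (SpatialTensor A B) where
  star_involutive x := by
    induction x using Completion.induction_on with
    | hp => exact isClosed_eq (continuous_star'.comp continuous_star') continuous_id
    | ih x => rw [← coe_star, ← coe_star, star_star]
  star_mul x y := by
    induction x, y using Completion.induction_on₂ with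
    | hp =>
      exact isClosed_eq (continuous_star'.comp (by fun_prop))
        ((continuous_star'.comp continuous_snd).mul (continuous_star'.comp continuous_fst))
    | ih x y =>
      rw [← Completion.coe_mul, ← coe_star, ← coe_star, ← coe_star, star_mul, Completion.coe_mul]
  star_add x y := by
    induction x, y using Completion.induction_on₂ with
    | hp =>
      exact isClosed_eq (continuous_star'.comp (by fun_prop))
        ((continuous_star'.comp continuous_fst).add (continuous_star'.comp continuous_snd))
    | ih x y =>
      rw [← Completion.coe_add, ← coe_star, ← coe_star, ← coe_star, star_add, Completion.coe_add]

instance : CStarAlgebra (SpatialTensor A B) where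
  __ := (inferInstance : NormedRing (SpatialTensor A B))
  __ := (inferInstance : StarRing (SpatialTensor A B))
  __ := (inferInstance : Algebra ℂ (SpatialTensor A B))
  norm_smul_le := norm_smul_le
  complete := CompleteSpace.complete
  norm_mul_self_le x := by
    induction x using Completion.induction_on with
    | hp =>
      exact isClosed_le (by fun_prop) (continuous_norm.comp (continuous_star'.mul continuous_id))
    | ih x =>
      rw [← coe_star, ← Completion.coe_mul, Completion.norm_coe, Completion.norm_coe]
      exact PreSpatial.spatialNorm_sq_le x
  star_smul r x := by
    induction x using Completion.induction_on with
    | hp =>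
      exact isClosed_eq (continuous_star'.comp (continuous_const_smul r))
        (continuous_star'.const_smul (star r))
    | ih x => rw [← Completion.coe_smul, ← coe_star, ← coe_star, star_smul, Completion.coe_smul]

/-- The canonical map of the algebraic tensor product into its completion. -/
def ofAlgebraic : A ⊗[ℂ] B →ₐ[ℂ] SpatialTensor A B where
  toFun t := ((show PreSpatial A B from t : PreSpatial A B) : SpatialTensor A B)
  map_one' := Completion.coe_one (PreSpatial A B)
  map_mul' := fun s t => Completion.coe_mul (α := PreSpatial A B) s t
  map_zero' := Completion.coe_zero (α := PreSpatial A B)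
  map_add' := fun s t => Completion.coe_add (α := PreSpatial A B) s t
  commutes' _ := rfl

/-- The elementary tensor `a ⊗ b`. -/
def tmul (a : A) (b : B) : SpatialTensor A B := ofAlgebraic (a ⊗ₜ b)

theorem ofAlgebraic_star (t : A ⊗[ℂ] B) : ofAlgebraic (star t) = star (ofAlgebraic t) :=
  coe_star (A := A) (B := B) t

theorem norm_ofAlgebraic (t : A ⊗[ℂ] B) : ‖(ofAlgebraic t : SpatialTensor A B)‖ = PreSpatial.spatialNorm t :=
  Completion.norm_coe (show PreSpatial A B from t)

/-- A homomorphism of the algebraic tensor product, seen on the normed ring `PreSpatial A B`. -/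
def preHom {D : Type u} [CStarAlgebra D] (F : A ⊗[ℂ] B →ₐ[ℂ] D) : PreSpatial A B →+* D :=
  F.toRingHom

theorem continuous_preHom {D : Type u} [CStarAlgebra D] (F : A ⊗[ℂ] B →ₐ[ℂ] D)
    (hF : ∀ t, ‖F t‖ ≤ PreSpatial.spatialNorm t) : Continuous (preHom F) :=
  AddMonoidHomClass.continuous_of_bound (preHom F) 1 fun t => by rw [one_mul]; exact hF t

/-- Extension by continuity of a contractive `*`-homomorphism from the algebraic tensor product. -/
def lift {D : Type u} [CStarAlgebra D] (F : A ⊗[ℂ] B →ₐ[ℂ] D)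
    (hstar : ∀ t, F (star t) = star (F t))
    (hF : ∀ t, ‖F t‖ ≤ PreSpatial.spatialNorm t) : SpatialTensor A B →⋆ₐ[ℂ] D :=
  { Completion.extensionHom (preHom F) (continuous_preHom F hF) with
    commutes' := fun r =>
      (Completion.extensionHom_coe (preHom F) (continuous_preHom F hF) _).trans (F.commutes r)
    map_star' := fun x => by
      change Completion.extension (preHom F) (star x) = star (Completion.extension (preHom F) x)
      have huc : UniformContinuous (preHom F) :=
        uniformContinuous_addMonoidHom_of_continuous (continuous_preHom F hF)
      induction x using Completion.induction_on with
      | hp =>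
        exact isClosed_eq (Completion.continuous_extension.comp continuous_star')
          (continuous_star.comp Completion.continuous_extension)
      | ih x =>
        rw [← coe_star, Completion.extension_coe huc, Completion.extension_coe huc]
        exact hstar x }

theorem lift_ofAlgebraic {D : Type u} [CStarAlgebra D] (F : A ⊗[ℂ] B →ₐ[ℂ] D)
    (hstar : ∀ t, F (star t) = star (F t))
    (hF : ∀ t, ‖F t‖ ≤ PreSpatial.spatialNorm t) (t : A ⊗[ℂ] B) :
    lift F hstar hF (ofAlgebraic t) = F t :=
  Completion.extensionHom_coe (preHom F) (continuous_preHom F hF) (show PreSpatial A B from t)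

/-- The `*`-homomorphism `f ⊗ g` between spatial tensor products. -/
def map (f : A →⋆ₐ[ℂ] A') (g : B →⋆ₐ[ℂ] B') : SpatialTensor A B →⋆ₐ[ℂ] SpatialTensor A' B' :=
  lift (ofAlgebraic.comp (Algebra.TensorProduct.map f.toAlgHom g.toAlgHom))
    (fun t => by
      have h : Algebra.TensorProduct.map f.toAlgHom g.toAlgHom (star t) =
          star (Algebra.TensorProduct.map f.toAlgHom g.toAlgHom t) := by
        induction t with
        | zero => simp
        | add x y hx hy => rw [star_add, map_add, hx, hy, map_add, star_add]
        | tmul a b => simp [map_star]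
      change ofAlgebraic (Algebra.TensorProduct.map f.toAlgHom g.toAlgHom (star t)) = _
      rw [h, ofAlgebraic_star]; rfl)
    (fun t => by
      change ‖ofAlgebraic (Algebra.TensorProduct.map f.toAlgHom g.toAlgHom t)‖ ≤ _
      rw [norm_ofAlgebraic]
      refine PreSpatial.spatialNorm_le (PreSpatial.spatialNorm_nonneg t) fun π ρ => ?_
      rw [← HilbertRep.tensor_comap]
      exact PreSpatial.norm_tensor_le _ _ t)

theorem map_tmul (f : A →⋆ₐ[ℂ] A') (g : B →⋆ₐ[ℂ] B') (a : A) (b : B) :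
    map f g (tmul a b) = tmul (f a) (g b) :=
  lift_ofAlgebraic _ _ _ _

variable (A B) in
/-- The embedding `a ↦ a ⊗ 1`. -/
def inl : A →⋆ₐ[ℂ] SpatialTensor A B where
  toAlgHom := ofAlgebraic.comp Algebra.TensorProduct.includeLeft
  map_star' a := by
    change tmul (star a) 1 = star (tmul a 1)
    rw [tmul, tmul, ← ofAlgebraic_star, TensorProduct.star_tmul, star_one]

end SpatialTensor

end Spatial

section Slice

open Complex in
/-- Every real functional that is nonnegative on the positive cone is, on the positive cone, the
restriction of a positive linear functional. -/
theorem exists_positiveLinearMap {A : Type u} [CStarAlgebra A] [PartialOrder A] [StarOrderedRing A]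
    (f : A →L[ℝ] ℝ) (hf : ∀ a, 0 ≤ a → 0 ≤ f a) :
    ∃ F : A →ₚ[ℂ] ℂ, ∀ a, 0 ≤ a → F a = f a := by
  let g : A →ₗ[ℝ] ℝ := f.toLinearMap ∘ₗ (selfAdjoint.submodule ℝ A).subtype ∘ₗ realPart
  let F : A →ₗ[ℂ] ℂ := Module.Dual.extendRCLike g
  have hF : ∀ a, IsSelfAdjoint a → F a = f a := by
    intro a ha
    have h1 : g a = f a := congrArg f ha.coe_realPart
    have h2 : g (I • a) = 0 := by
      change f (realPart (I • a) : A) = 0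
      rw [realPart_I_smul, ha.imaginaryPart]; simp
    have h3 : F a = (g a : ℂ) - I * (g (I • a) : ℂ) := Module.Dual.extendRCLike_apply g a
    rw [h3, h1, h2]; simp
  refine ⟨PositiveLinearMap.mk₀ F fun a ha => ?_, fun a ha => hF a (.of_nonneg ha)⟩
  rw [hF a (.of_nonneg ha)]
  exact_mod_cast hf a ha

/-- The representation associated with a positive linear functional. -/
def HilbertRep.gns {A : Type u} [CStarAlgebra A] [PartialOrder A] [StarOrderedRing A]
    (f : A →ₚ[ℂ] ℂ) : HilbertRep A where
  H := f.GNS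
  toHom := f.gnsStarAlgHom

/-- The cyclic vector of the representation associated with a positive linear functional. -/
def HilbertRep.gnsVector {A : Type u} [CStarAlgebra A] [PartialOrder A] [StarOrderedRing A]
    (f : A →ₚ[ℂ] ℂ) : (HilbertRep.gns f).H :=
  ((f.toPreGNS 1 : f.PreGNS) : f.GNS)

theorem HilbertRep.inner_gns {A : Type u} [CStarAlgebra A] [PartialOrder A] [StarOrderedRing A]
    (f : A →ₚ[ℂ] ℂ) (a : A) :
    inner ℂ (gnsVector f) ((gns f).toHom a (gnsVector f)) = f a := by
  change inner ℂ ((f.toPreGNS 1 : f.PreGNS) : f.GNS)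
    (f.gnsNonUnitalStarAlgHom a ((f.toPreGNS 1 : f.PreGNS) : f.GNS)) = f a
  rw [PositiveLinearMap.gnsNonUnitalStarAlgHom_apply_coe, Completion.inner_coe,
    PositiveLinearMap.preGNS_inner_def]
  simp

theorem HilbertRep.norm_le_of_forall {A : Type u} [CStarAlgebra A] {a : A} {M : ℝ} (hM : 0 ≤ M)
    (h : ∀ π : HilbertRep A, ‖π.toHom a‖ ≤ M) : ‖a‖ ≤ M := by
  let _ := CStarAlgebra.spectralOrder A
  have _ := CStarAlgebra.spectralOrderedRing A
  by_contra! hlt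
  have hnot : ¬ (0 : A) ≤ algebraMap ℝ A (M ^ 2) - star a * a := by
    intro h0
    rw [sub_nonneg, ← CStarAlgebra.norm_le_iff_le_algebraMap _ (sq_nonneg M)
      (star_mul_self_nonneg a), CStarRing.norm_star_mul_self] at h0
    nlinarith
  obtain ⟨f, hf, hneg⟩ := ProperCone.hyperplane_separation_point (ProperCone.positive ℝ A) hnot
  obtain ⟨F, hF⟩ := exists_positiveLinearMap f hf
  have h1 : ‖(gns F).toHom a (gnsVector F)‖ ^ 2 = f (star a * a) := by
    have : ((‖(gns F).toHom a (gnsVector F)‖ ^ 2 : ℝ) : ℂ) = F (star a * a) := by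
      rw [← inner_gns F (star a * a), map_mul, map_star]
      change _ = inner ℂ (gnsVector F) (star ((gns F).toHom a) ((gns F).toHom a (gnsVector F)))
      rw [ContinuousLinearMap.star_eq_adjoint, ContinuousLinearMap.adjoint_inner_right,
        inner_self_eq_norm_sq_to_K]
      simp
    rw [hF _ (star_mul_self_nonneg a)] at this
    exact_mod_cast this
  have h2 : ‖gnsVector F‖ ^ 2 = f 1 := by
    have : ((‖gnsVector F‖ ^ 2 : ℝ) : ℂ) = F 1 := by
      rw [← inner_gns F 1, map_one]
      change _ = inner ℂ (gnsVector F) (gnsVector F)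
      rw [inner_self_eq_norm_sq_to_K]
      simp
    rw [hF _ zero_le_one] at this
    exact_mod_cast this
  have h3 : ‖(gns F).toHom a (gnsVector F)‖ ≤ M * ‖gnsVector F‖ :=
    ((gns F).toHom a).le_of_opNorm_le (h (gns F)) _
  rw [map_sub, Algebra.algebraMap_eq_smul_one, map_smul, smul_eq_mul, ← h1, ← h2] at hneg
  have h4 := pow_le_pow_left₀ (norm_nonneg _) h3 2
  rw [mul_pow] at h4
  linarith

variable {A B : Type u} [CStarAlgebra A] [CStarAlgebra B]

theorem norm_inner_tensor_le (π : HilbertRep A) (ρ : HilbertRep B) (t : A ⊗[ℂ] B) (ξ ξ' : π.H)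
    (η η' : ρ.H) :
    ‖(inner ℂ (HilbertTensor.incl (ξ' ⊗ₜ η')) (π.tensor ρ t (HilbertTensor.incl (ξ ⊗ₜ η))) : ℂ)‖ ≤
      PreSpatial.spatialNorm t * (‖ξ'‖ * ‖η'‖) * (‖ξ‖ * ‖η‖) := by
  have hn (x : π.H) (y : ρ.H) : ‖HilbertTensor.incl (x ⊗ₜ[ℂ] y)‖ = ‖x‖ * ‖y‖ :=
    (Completion.norm_coe _).trans (TensorProduct.norm_tmul x y)
  refine (norm_inner_le_norm _ _).trans ?_
  have h := (π.tensor ρ t).le_of_opNorm_le (PreSpatial.norm_tensor_le π ρ t)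
    (HilbertTensor.incl (ξ ⊗ₜ η))
  rw [hn] at h ⊢
  calc ‖ξ'‖ * ‖η'‖ * ‖π.tensor ρ t (HilbertTensor.incl (ξ ⊗ₜ η))‖
      ≤ ‖ξ'‖ * ‖η'‖ * (PreSpatial.spatialNorm t * (‖ξ‖ * ‖η‖)) := by gcongr
    _ = _ := by ring

theorem opNorm_le_of_inner {H : Type u} [NormedAddCommGroup H] [InnerProductSpace ℂ H]
    (T : H →L[ℂ] H) {M : ℝ} (hM : 0 ≤ M) (h : ∀ x y, ‖(inner ℂ y (T x) : ℂ)‖ ≤ M * ‖y‖ * ‖x‖) :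
    ‖T‖ ≤ M := by
  refine T.opNorm_le_bound hM fun x => ?_
  have h1 := h x (T x)
  rw [inner_self_eq_norm_sq_to_K] at h1
  have h2 : ‖T x‖ * ‖T x‖ ≤ M * ‖T x‖ * ‖x‖ := by simpa [sq] using h1
  by_cases h0 : ‖T x‖ = 0
  · rw [h0]; positivity
  · have : 0 < ‖T x‖ := lt_of_le_of_ne (norm_nonneg _) (Ne.symm h0)
    nlinarith

/-- The slice map `id ⊗ h` on the algebraic tensor product. -/
def algSliceRight (h : B →ₗ[ℂ] ℂ) : A ⊗[ℂ] B →ₗ[ℂ] A :=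
  TensorProduct.rid ℂ A ∘ₗ TensorProduct.map LinearMap.id h

/-- The slice map `h ⊗ id` on the algebraic tensor product. -/
def algSliceLeft (h : A →ₗ[ℂ] ℂ) : A ⊗[ℂ] B →ₗ[ℂ] B :=
  TensorProduct.lid ℂ B ∘ₗ TensorProduct.map h LinearMap.id

theorem norm_algSliceRight_le [PartialOrder B] [StarOrderedRing B] (h : B →ₚ[ℂ] ℂ)
    (t : A ⊗[ℂ] B) : ‖algSliceRight h.toLinearMap t‖ ≤
      ‖HilbertRep.gnsVector h‖ ^ 2 * PreSpatial.spatialNorm t := by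
  have h0 := PreSpatial.spatialNorm_nonneg t
  refine HilbertRep.norm_le_of_forall (by positivity) fun π =>
    opNorm_le_of_inner _ (by positivity) fun ξ ξ' => ?_
  have key : inner ℂ ξ' (π.toHom (algSliceRight h.toLinearMap t) ξ) =
      inner ℂ (HilbertTensor.incl (ξ' ⊗ₜ HilbertRep.gnsVector h))
        (π.tensor (HilbertRep.gns h) t (HilbertTensor.incl (ξ ⊗ₜ HilbertRep.gnsVector h))) := by
    induction t with
    | zero => simp
    | add x y hx hy =>
      simp only [map_add, add_apply, inner_add_right,
        hx (PreSpatial.spatialNorm_nonneg x), hy (PreSpatial.spatialNorm_nonneg y)]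
    | tmul a b =>
      rw [HilbertRep.tensor_tmul, HilbertTensor.op_incl, HilbertTensor.inner_incl,
        TensorProduct.map_tmul, TensorProduct.inner_tmul]
      have h1 : algSliceRight h.toLinearMap (a ⊗ₜ[ℂ] b) = h b • a := by
        simp [algSliceRight]
      rw [h1, map_smul]
      change inner ℂ ξ' (h b • π.toHom a ξ) = inner ℂ ξ' (π.toHom a ξ) *
        inner ℂ (HilbertRep.gnsVector h)
          ((HilbertRep.gns h).toHom b (HilbertRep.gnsVector h))
      rw [HilbertRep.inner_gns, inner_smul_right, mul_comm]
  rw [key]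
  refine (norm_inner_tensor_le _ _ _ _ _ _ _).trans (le_of_eq ?_)
  ring

theorem norm_algSliceLeft_le [PartialOrder A] [StarOrderedRing A] (h : A →ₚ[ℂ] ℂ)
    (t : A ⊗[ℂ] B) : ‖algSliceLeft h.toLinearMap t‖ ≤
      ‖HilbertRep.gnsVector h‖ ^ 2 * PreSpatial.spatialNorm t := by
  have h0 := PreSpatial.spatialNorm_nonneg t
  refine HilbertRep.norm_le_of_forall (by positivity) fun π =>
    opNorm_le_of_inner _ (by positivity) fun ξ ξ' => ?_
  have key : inner ℂ ξ' (π.toHom (algSliceLeft h.toLinearMap t) ξ) =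
      inner ℂ (HilbertTensor.incl (HilbertRep.gnsVector h ⊗ₜ ξ'))
        ((HilbertRep.gns h).tensor π t
          (HilbertTensor.incl (HilbertRep.gnsVector h ⊗ₜ ξ))) := by
    induction t with
    | zero => simp
    | add x y hx hy =>
      simp only [map_add, add_apply, inner_add_right,
        hx (PreSpatial.spatialNorm_nonneg x), hy (PreSpatial.spatialNorm_nonneg y)]
    | tmul a b =>
      rw [HilbertRep.tensor_tmul, HilbertTensor.op_incl, HilbertTensor.inner_incl,
        TensorProduct.map_tmul, TensorProduct.inner_tmul]
      have h1 : algSliceLeft h.toLinearMap (a ⊗ₜ[ℂ] b) = h a • b := by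
        simp [algSliceLeft]
      rw [h1, map_smul]
      change inner ℂ ξ' (h a • π.toHom b ξ) = inner ℂ (HilbertRep.gnsVector h)
          ((HilbertRep.gns h).toHom a (HilbertRep.gnsVector h)) * inner ℂ ξ' (π.toHom b ξ)
      rw [HilbertRep.inner_gns, inner_smul_right]
  rw [key]
  refine (norm_inner_tensor_le _ _ _ _ _ _ _).trans (le_of_eq ?_)
  ring

namespace SpatialTensor

/-- Extension by continuity of a bounded linear map from the algebraic tensor product. -/
def extendL {D : Type u} [CStarAlgebra D] (F : A ⊗[ℂ] B →ₗ[ℂ] D) (M : ℝ)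
    (hF : ∀ t, ‖F t‖ ≤ M * PreSpatial.spatialNorm t) : SpatialTensor A B →L[ℂ] D :=
  (LinearMap.mkContinuous (show PreSpatial A B →ₗ[ℂ] D from F) M hF).fromCompletion

theorem extendL_ofAlgebraic {D : Type u} [CStarAlgebra D] (F : A ⊗[ℂ] B →ₗ[ℂ] D) (M : ℝ)
    (hF : ∀ t, ‖F t‖ ≤ M * PreSpatial.spatialNorm t) (t : A ⊗[ℂ] B) :
    extendL F M hF (ofAlgebraic t) = F t :=
  ContinuousLinearMap.fromCompletion_apply_coe _ (show PreSpatial A B from t)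

/-- The slice map `id ⊗ h : A ⊗ B → A`. -/
def sliceRight [PartialOrder B] [StarOrderedRing B] (h : B →ₚ[ℂ] ℂ) : SpatialTensor A B →L[ℂ] A :=
  extendL (algSliceRight h.toLinearMap) _ (norm_algSliceRight_le h)

theorem sliceRight_tmul [PartialOrder B] [StarOrderedRing B] (h : B →ₚ[ℂ] ℂ) (a : A) (b : B) :
    sliceRight h (tmul a b) = h b • a :=
  (extendL_ofAlgebraic _ _ _ _).trans (by simp [algSliceRight])

/-- The slice map `h ⊗ id : A ⊗ B → B`. -/
def sliceLeft [PartialOrder A] [StarOrderedRing A] (h : A →ₚ[ℂ] ℂ) : SpatialTensor A B →L[ℂ] B :=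
  extendL (algSliceLeft h.toLinearMap) _ (norm_algSliceLeft_le h)

theorem sliceLeft_tmul [PartialOrder A] [StarOrderedRing A] (h : A →ₚ[ℂ] ℂ) (a : A) (b : B) :
    sliceLeft h (tmul a b) = h a • b :=
  (extendL_ofAlgebraic _ _ _ _).trans (by simp [algSliceLeft])

end SpatialTensor

end Slice

section Associator

variable {A B C : Type u} [CStarAlgebra A] [CStarAlgebra B] [CStarAlgebra C]

/-- The graph of the canonical isomorphism `(A ⊗ B) ⊗ C ≅ A ⊗ (B ⊗ C)`, as the closed linear span
of the pairs `((a ⊗ b) ⊗ c, a ⊗ (b ⊗ c))`. -/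
def SpatialTensor.assocGraph :
    Submodule ℂ (SpatialTensor (SpatialTensor A B) C × SpatialTensor A (SpatialTensor B C)) :=
  (Submodule.span ℂ (Set.range fun p : A × B × C =>
    (SpatialTensor.tmul (SpatialTensor.tmul p.1 p.2.1) p.2.2,
      SpatialTensor.tmul p.1 (SpatialTensor.tmul p.2.1 p.2.2)))).topologicalClosure

end Associator

/-- A compact quantum group in the sense of Woronowicz. -/
structure CompactQuantumGroup (A : Type u) [CStarAlgebra A] where
  /-- The coproduct. -/
  comul : A →⋆ₐ[ℂ] SpatialTensor A A
  /-- Coassociativity `(Δ ⊗ id) Δ = (id ⊗ Δ) Δ`. -/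
  coassoc : ∀ a : A, (SpatialTensor.map comul (StarAlgHom.id ℂ A) (comul a),
    SpatialTensor.map (StarAlgHom.id ℂ A) comul (comul a)) ∈ SpatialTensor.assocGraph
  dense_left : Dense (Submodule.span ℂ
    {x | ∃ b c : A, x = SpatialTensor.tmul b 1 * comul c} : Set (SpatialTensor A A))
  dense_right : Dense (Submodule.span ℂ
    {x | ∃ b c : A, x = SpatialTensor.tmul 1 b * comul c} : Set (SpatialTensor A A))

namespace CompactQuantumGroup

variable {A : Type u} [CStarAlgebra A]

/-- A positive functional `h` is the Haar state if it is normalized and left and right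
invariant. -/
structure IsHaarState [PartialOrder A] [StarOrderedRing A] (G : CompactQuantumGroup A)
    (h : A →ₚ[ℂ] ℂ) : Prop where
  map_one : h 1 = 1
  right_invariant : ∀ a, SpatialTensor.sliceRight h (G.comul a) = h a • (1 : A)
  left_invariant : ∀ a, SpatialTensor.sliceLeft h (G.comul a) = h a • (1 : A)

/-- An action of a compact quantum group on a unital C*-algebra. -/
structure Action (G : CompactQuantumGroup A) (C : Type u) [CStarAlgebra C] where
  toHom : C →⋆ₐ[ℂ] SpatialTensor C A
  /-- `(δ ⊗ id) δ = (id ⊗ Δ) δ`. -/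
  coassoc : ∀ c : C, (SpatialTensor.map toHom (StarAlgHom.id ℂ A) (toHom c),
    SpatialTensor.map (StarAlgHom.id ℂ C) G.comul (toHom c)) ∈ SpatialTensor.assocGraph

namespace Action

variable {G : CompactQuantumGroup A} {C : Type u} [CStarAlgebra C]

/-- The linear span of `(1 ⊗ A) δ(C)` is dense in `C ⊗ A`. -/
def IsNondegenerate (δ : G.Action C) : Prop :=
  Dense (Submodule.span ℂ
    {x | ∃ (a : A) (c : C), x = SpatialTensor.tmul 1 a * δ.toHom c} : Set (SpatialTensor C A))

/-- The fixed point algebra `{c | δ(c) = c ⊗ 1}`. -/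
def fixedPoints (δ : G.Action C) : Set C :=
  {c | δ.toHom c = SpatialTensor.tmul c 1}

/-- The action is ergodic if its fixed points are the scalar multiples of the unit. -/
def IsErgodic (δ : G.Action C) : Prop :=
  δ.fixedPoints = Set.range (algebraMap ℂ C)

/-- `δ(S) ⊆ S ⊗ A`, where `S ⊗ A` is the closed linear span of the elementary tensors. -/
def IsInvariant (δ : G.Action C) (S : Set C) : Prop :=
  ∀ s ∈ S, δ.toHom s ∈
    closure (Submodule.span ℂ {x | ∃ c ∈ S, ∃ a : A, x = SpatialTensor.tmul c a} :
      Set (SpatialTensor C A))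

end Action

end CompactQuantumGroup

/-- A C*-subalgebra `B` of `C` is hereditary if `0 ≤ a ≤ b ∈ B` implies `a ∈ B`. -/
def IsHereditary {C : Type u} [CStarAlgebra C] [PartialOrder C]
    (B : NonUnitalStarSubalgebra ℂ C) : Prop :=
  ∀ a b : C, 0 ≤ a → a ≤ b → b ∈ B → a ∈ B

/-- The enveloping von Neumann algebra of a C*-algebra, realized as its second dual. -/
abbrev EnvelopingVN (C : Type u) [CStarAlgebra C] : Type u := StrongDual ℂ (StrongDual ℂ C)

namespace EnvelopingVN

variable {C D : Type u} [CStarAlgebra C] [CStarAlgebra D]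

/-- The functional `a ↦ G (b ↦ φ (a * b))`. -/
def rightAct (G : EnvelopingVN C) (φ : StrongDual ℂ C) : StrongDual ℂ C :=
  G ∘L (ContinuousLinearMap.compL ℂ C C ℂ φ) ∘L (ContinuousLinearMap.mul ℂ C)

/-- The multiplication of the enveloping von Neumann algebra (the Arens product), which is
`(F * G) φ = F (a ↦ G (b ↦ φ (a * b)))`. -/
def mul (F G : EnvelopingVN C) : EnvelopingVN C :=
  F ∘L (ContinuousLinearMap.compL ℂ C (StrongDual ℂ C) ℂ G) ∘L
    ((ContinuousLinearMap.compL ℂ C (C →L[ℂ] C) (StrongDual ℂ C)).flip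
      (ContinuousLinearMap.mul ℂ C)) ∘L
    (ContinuousLinearMap.compL ℂ C C ℂ)

theorem mul_apply (F G : EnvelopingVN C) (φ : StrongDual ℂ C) : mul F G φ = F (rightAct G φ) := rfl

theorem rightAct_apply (G : EnvelopingVN C) (φ : StrongDual ℂ C) (a : C) :
    rightAct G φ a = G (φ ∘L ContinuousLinearMap.mul ℂ C a) := rfl

/-- The adjoint functional `a ↦ conj (φ (a⋆))`. -/
def adjFunctional (φ : StrongDual ℂ C) : StrongDual ℂ C :=
  ((starL ℂ : ℂ ≃L⋆[ℂ] ℂ) : ℂ →L⋆[ℂ] ℂ) ∘SL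
    (φ ∘SL ((starL ℂ : C ≃L⋆[ℂ] C) : C →L⋆[ℂ] C))

theorem adjFunctional_apply (φ : StrongDual ℂ C) (a : C) :
    adjFunctional φ a = star (φ (star a)) := rfl

/-- A projection: a self-adjoint idempotent. -/
structure IsProjection (p : EnvelopingVN C) : Prop where
  idempotent : mul p p = p
  selfAdjoint : ∀ φ : StrongDual ℂ C, p (adjFunctional φ) = star (p φ)

/-- A functional is positive if it is nonnegative on all `a⋆ a`. -/
def IsPositive (φ : StrongDual ℂ C) : Prop := ∀ a : C, 0 ≤ φ (star a * a)

/-- The order of the enveloping von Neumann algebra, tested on all positive functionals of `C`. -/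
def le (F G : EnvelopingVN C) : Prop := ∀ φ : StrongDual ℂ C, IsPositive φ → F φ ≤ G φ

/-- The unit. -/
def unit (C : Type u) [CStarAlgebra C] : EnvelopingVN C :=
  NormedSpace.inclusionInDoubleDual ℂ C 1

/-- The normal extension `f'' : C'' → D''` of a `*`-homomorphism, i.e. its second transpose. -/
def map (f : C →⋆ₐ[ℂ] D) (F : EnvelopingVN C) : EnvelopingVN D :=
  F ∘L (ContinuousLinearMap.compL ℂ C D ℂ).flip
    ⟨f.toAlgHom.toLinearMap, (NonUnitalStarAlgHom.instContinuousLinearMapClassComplex).map_continuous f⟩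

theorem map_apply (f : C →⋆ₐ[ℂ] D) (F : EnvelopingVN C) (ψ : StrongDual ℂ D)
    (φ : StrongDual ℂ C) (h : ∀ c, φ c = ψ (f c)) : map f F ψ = F φ :=
  congrArg F (ContinuousLinearMap.ext fun c => (h c).symm)

/-- A projection is open if it is the limit of an increasing net of positive elements of `C`. -/
def IsOpenProjection [PartialOrder C] (p : EnvelopingVN C) : Prop :=
  IsProjection p ∧ ∃ (ι : Type u) (_ : Preorder ι) (_ : IsDirectedOrder ι) (_ : Nonempty ι)
    (x : ι → C), Monotone x ∧ (∀ i, 0 ≤ x i) ∧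
      ∀ φ : StrongDual ℂ C, Filter.Tendsto (fun i => φ (x i)) Filter.atTop (nhds (p φ))

end EnvelopingVN

end

noncomputable section

/-- A `*`-homomorphism between C*-algebras as a continuous linear map. -/
def StarAlgHom.toCLM {A B : Type u} [CStarAlgebra A] [CStarAlgebra B] (f : A →⋆ₐ[ℂ] B) :
    A →L[ℂ] B :=
  ⟨f.toAlgHom.toLinearMap,
    (NonUnitalStarAlgHom.instContinuousLinearMapClassComplex).map_continuous f⟩

@[simp] theorem StarAlgHom.toCLM_apply {A B : Type u} [CStarAlgebra A] [CStarAlgebra B]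
    (f : A →⋆ₐ[ℂ] B) (a : A) : f.toCLM a = f a := rfl

theorem StarAlgHom.continuous_coe {A B : Type u} [CStarAlgebra A] [CStarAlgebra B]
    (f : A →⋆ₐ[ℂ] B) : Continuous f := f.toCLM.continuous

theorem HilbertTensor.incl_smul {H K : Type u} [NormedAddCommGroup H] [InnerProductSpace ℂ H]
    [NormedAddCommGroup K] [InnerProductSpace ℂ K] (r : ℂ) (t : H ⊗[ℂ] K) :
    incl (r • t) = r • incl t := map_smul incl r t

theorem HilbertTensor.incl_mem_span {H K : Type u} [NormedAddCommGroup H] [InnerProductSpace ℂ H]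
    [NormedAddCommGroup K] [InnerProductSpace ℂ K] (t : H ⊗[ℂ] K) :
    incl t ∈ Submodule.span ℂ {v | ∃ (ξ : H) (η : K), v = incl (ξ ⊗ₜ[ℂ] η)} := by
  induction t with
  | zero => rw [map_zero]; exact Submodule.zero_mem _
  | add s t hs ht => rw [map_add]; exact Submodule.add_mem _ hs ht
  | tmul ξ η => exact Submodule.subset_span ⟨ξ, η, rfl⟩

namespace HilbertRep

variable {A B : Type u} [CStarAlgebra A] [CStarAlgebra B]

/-- The functional `a ↦ ⟨ξ', π(a) ξ⟩`. -/
def coeff (π : HilbertRep A) (ξ' ξ : π.H) : StrongDual ℂ A :=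
  LinearMap.mkContinuous
    { toFun := fun a => inner ℂ ξ' (π.toHom a ξ)
      map_add' := fun a b => by rw [map_add, add_apply, inner_add_right]
      map_smul' := fun r a => by rw [map_smul, smul_apply, inner_smul_right]; rfl }
    (‖ξ'‖ * ‖ξ‖) fun a => by
      refine (norm_inner_le_norm _ _).trans ?_
      have h := (π.toHom a).le_of_opNorm_le (π.norm_toHom_le a) ξ
      calc ‖ξ'‖ * ‖π.toHom a ξ‖ ≤ ‖ξ'‖ * (‖a‖ * ‖ξ‖) := by gcongr
        _ = _ := by ring

theorem coeff_apply (π : HilbertRep A) (ξ' ξ : π.H) (a : A) :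
    π.coeff ξ' ξ a = inner ℂ ξ' (π.toHom a ξ) := rfl

theorem inner_toHom_star_mul (π : HilbertRep A) (ξ' ξ : π.H) (a b : A) :
    inner ℂ ξ' (π.toHom (star a * b) ξ) = inner ℂ (π.toHom a ξ') (π.toHom b ξ) := by
  rw [map_mul, map_star]
  change inner ℂ ξ' (star (π.toHom a) (π.toHom b ξ)) = _
  rw [ContinuousLinearMap.star_eq_adjoint, ContinuousLinearMap.adjoint_inner_right]

theorem inner_toHom_star_mul_self (π : HilbertRep A) (ξ : π.H) (a : A) :
    inner ℂ ξ (π.toHom (star a * a) ξ) = ((‖π.toHom a ξ‖ ^ 2 : ℝ) : ℂ) := by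
  rw [inner_toHom_star_mul, inner_self_eq_norm_sq_to_K]
  simp

theorem isPositive_coeff (π : HilbertRep A) (ξ : π.H) : EnvelopingVN.IsPositive (π.coeff ξ ξ) := by
  intro a
  rw [coeff_apply, inner_toHom_star_mul_self, Complex.zero_le_real]
  positivity

end HilbertRep

section Order

variable {A : Type u} [CStarAlgebra A] [PartialOrder A] [StarOrderedRing A]

/-- A bounded positive functional as a positive linear map. -/
def EnvelopingVN.IsPositive.toPositive {φ : StrongDual ℂ A} (hφ : EnvelopingVN.IsPositive φ) :
    A →ₚ[ℂ] ℂ :=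
  PositiveLinearMap.mk₀ φ.toLinearMap fun a ha => by
    obtain ⟨b, rfl⟩ := CStarAlgebra.nonneg_iff_eq_star_mul_self.mp ha
    exact hφ b

@[simp] theorem EnvelopingVN.IsPositive.toPositive_apply {φ : StrongDual ℂ A}
    (hφ : EnvelopingVN.IsPositive φ) (a : A) : hφ.toPositive a = φ a := rfl

theorem EnvelopingVN.IsPositive.nonneg {φ : StrongDual ℂ A} (hφ : EnvelopingVN.IsPositive φ)
    {a : A} (ha : 0 ≤ a) : 0 ≤ φ a := by
  obtain ⟨b, rfl⟩ := CStarAlgebra.nonneg_iff_eq_star_mul_self.mp ha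
  exact hφ b

theorem EnvelopingVN.IsPositive.monotone {φ : StrongDual ℂ A} (hφ : EnvelopingVN.IsPositive φ) :
    Monotone φ := by
  intro a b hab
  have := hφ.nonneg (sub_nonneg.mpr hab)
  rwa [map_sub, sub_nonneg] at this

/-- The positive functional `a ↦ ⟨ξ, π(a) ξ⟩`. -/
def HilbertRep.vecFunctional (π : HilbertRep A) (ξ : π.H) : A →ₚ[ℂ] ℂ :=
  (π.isPositive_coeff ξ).toPositive

theorem nonneg_of_forall_positive {a : A} (ha : IsSelfAdjoint a)
    (h : ∀ F : A →ₚ[ℂ] ℂ, 0 ≤ F a) : 0 ≤ a := by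
  by_contra hnot
  obtain ⟨f, hf, hneg⟩ := ProperCone.hyperplane_separation_point (ProperCone.positive ℝ A) hnot
  obtain ⟨F, hF⟩ := exists_positiveLinearMap f hf
  have h1 := h F
  rw [← CFC.posPart_sub_negPart a ha] at h1 hneg
  rw [map_sub, hF _ (CFC.posPart_nonneg a), hF _ (CFC.negPart_nonneg a), ← Complex.ofReal_sub,
    Complex.zero_le_real] at h1
  rw [map_sub] at hneg
  linarith

theorem nonneg_of_forall_inner {a : A} (ha : IsSelfAdjoint a)
    (h : ∀ (π : HilbertRep A) (ξ : π.H), 0 ≤ inner ℂ ξ (π.toHom a ξ)) : 0 ≤ a :=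
  nonneg_of_forall_positive ha fun F => by
    rw [← HilbertRep.inner_gns F a]
    exact h _ _

theorem norm_apply_le_of_positive (F : A →ₚ[ℂ] ℂ) (a : A) : ‖F a‖ ≤ (F 1).re * ‖a‖ := by
  have h1 : ((‖HilbertRep.gnsVector F‖ ^ 2 : ℝ) : ℂ) = F 1 := by
    have := HilbertRep.inner_toHom_star_mul_self (HilbertRep.gns F) (HilbertRep.gnsVector F) 1
    rw [star_one, one_mul, HilbertRep.inner_gns, map_one (HilbertRep.gns F).toHom] at this
    exact this.symm
  rw [← h1, Complex.ofReal_re, ← HilbertRep.inner_gns F a]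
  refine (norm_inner_le_norm _ _).trans ?_
  have h2 := ((HilbertRep.gns F).toHom a).le_of_opNorm_le ((HilbertRep.gns F).norm_toHom_le a)
    (HilbertRep.gnsVector F)
  nlinarith [norm_nonneg (HilbertRep.gnsVector F)]

/-- A positive linear functional as a bounded functional. -/
def PositiveLinearMap.toDual (F : A →ₚ[ℂ] ℂ) : StrongDual ℂ A :=
  F.toLinearMap.mkContinuous _ (norm_apply_le_of_positive F)

theorem PositiveLinearMap.toDual_apply (F : A →ₚ[ℂ] ℂ) (a : A) : F.toDual a = F a := rfl

theorem PositiveLinearMap.isPositive_toDual (F : A →ₚ[ℂ] ℂ) :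
    EnvelopingVN.IsPositive F.toDual :=
  fun a => (OrderHomClass.mono F (star_mul_self_nonneg a)).trans' (map_zero F).ge

end Order

namespace SpatialTensor

variable {A B : Type u} [CStarAlgebra A] [CStarAlgebra B]

theorem induction_algebraic {p : SpatialTensor A B → Prop} (hp : IsClosed {x | p x})
    (h : ∀ t : A ⊗[ℂ] B, p (ofAlgebraic t)) (x : SpatialTensor A B) : p x :=
  Completion.induction_on x hp h

theorem clm_ext {E : Type*} [NormedAddCommGroup E] [NormedSpace ℂ E]
    {f g : SpatialTensor A B →L[ℂ] E} (h : ∀ a b, f (tmul a b) = g (tmul a b)) : f = g := by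
  ext x
  refine induction_algebraic (p := fun x => f x = g x)
    (isClosed_eq f.continuous g.continuous) (fun t => ?_) x
  induction t with
  | zero => simp
  | add s t hs ht => rw [map_add, map_add, map_add, hs, ht]
  | tmul a b => exact h a b

theorem tmul_mul_tmul (a a' : A) (b b' : B) :
    tmul a b * tmul a' b' = tmul (a * a') (b * b') := by
  rw [tmul, tmul, ← map_mul, Algebra.TensorProduct.tmul_mul_tmul, tmul]

theorem star_tmul (a : A) (b : B) : star (tmul a b) = tmul (star a) (star b) := by
  rw [tmul, ← ofAlgebraic_star, TensorProduct.star_tmul, tmul]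

/-- The tensor product of two representations, on the spatial tensor product. -/
def rep (π : HilbertRep A) (ρ : HilbertRep B) : HilbertRep (SpatialTensor A B) where
  H := HilbertTensor π.H ρ.H
  toHom := lift (π.tensor ρ) (HilbertRep.tensor_star π ρ) (PreSpatial.norm_tensor_le π ρ)

theorem rep_ofAlgebraic (π : HilbertRep A) (ρ : HilbertRep B) (t : A ⊗[ℂ] B) :
    (rep π ρ).toHom (ofAlgebraic t) = π.tensor ρ t :=
  lift_ofAlgebraic _ (HilbertRep.tensor_star π ρ) (PreSpatial.norm_tensor_le π ρ) t

/-- The elementary tensor of two vectors. -/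
def vec {π : HilbertRep A} {ρ : HilbertRep B} (ξ : π.H) (η : ρ.H) : (rep π ρ).H :=
  HilbertTensor.incl (ξ ⊗ₜ[ℂ] η)

theorem inner_rep_tmul {π : HilbertRep A} {ρ : HilbertRep B} (ξ' ξ : π.H) (η' η : ρ.H) (a : A)
    (b : B) : inner ℂ (vec ξ' η') ((rep π ρ).toHom (tmul a b) (vec ξ η)) =
      inner ℂ ξ' (π.toHom a ξ) * inner ℂ η' (ρ.toHom b η) := by
  rw [tmul, rep_ofAlgebraic]
  change inner ℂ (HilbertTensor.incl (ξ' ⊗ₜ η') : HilbertTensor π.H ρ.H)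
    (π.tensor ρ (a ⊗ₜ b) (HilbertTensor.incl (ξ ⊗ₜ η))) = _
  rw [HilbertRep.tensor_tmul, HilbertTensor.op_incl, HilbertTensor.inner_incl,
    TensorProduct.map_tmul, TensorProduct.inner_tmul]
  rfl

theorem vec_add_left {π : HilbertRep A} {ρ : HilbertRep B} (ξ ξ' : π.H) (η : ρ.H) :
    vec (ξ + ξ') η = vec ξ η + vec ξ' η := by
  rw [vec, TensorProduct.add_tmul, map_add]; rfl

theorem vec_smul_left {π : HilbertRep A} {ρ : HilbertRep B} (r : ℂ) (ξ : π.H) (η : ρ.H) :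
    vec (r • ξ) η = r • vec ξ η := by
  rw [vec, ← TensorProduct.smul_tmul']
  exact HilbertTensor.incl_smul r (ξ ⊗ₜ[ℂ] η)

theorem span_vec_dense (π : HilbertRep A) (ρ : HilbertRep B) :
    Dense (Submodule.span ℂ {v | ∃ (ξ : π.H) (η : ρ.H), v = vec ξ η} : Set (rep π ρ).H) := by
  refine (HilbertTensor.denseRange_incl (H := π.H) (K := ρ.H)).mono ?_
  rintro _ ⟨t, rfl⟩
  exact HilbertTensor.incl_mem_span t

theorem eq_zero_of_rep {x : SpatialTensor A B}
    (h : ∀ (π : HilbertRep A) (ρ : HilbertRep B), (rep π ρ).toHom x = 0) : x = 0 := by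
  have key : ∀ t : A ⊗[ℂ] B, ‖(ofAlgebraic t : SpatialTensor A B)‖ ≤
      ‖(ofAlgebraic t : SpatialTensor A B) - x‖ := fun t => by
    rw [norm_ofAlgebraic]
    refine PreSpatial.spatialNorm_le (norm_nonneg _) fun π ρ => ?_
    have := (rep π ρ).norm_toHom_le (ofAlgebraic t - x)
    rwa [map_sub, h, sub_zero, rep_ofAlgebraic] at this
  have hx : ‖x‖ ≤ ‖x - x‖ := induction_algebraic (p := fun y => ‖y‖ ≤ ‖y - x‖)
    (isClosed_le (by fun_prop) (by fun_prop)) key x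
  simpa using hx

theorem eq_zero_of_rep_vec {x : SpatialTensor A B}
    (h : ∀ (π : HilbertRep A) (ρ : HilbertRep B) (ξ : π.H) (η : ρ.H),
      (rep π ρ).toHom x (vec ξ η) = 0) : x = 0 := by
  refine eq_zero_of_rep fun π ρ => ContinuousLinearMap.ext_on (span_vec_dense π ρ) ?_
  rintro _ ⟨ξ, η, rfl⟩
  exact h π ρ ξ η

theorem inner_sliceRight [PartialOrder B] [StarOrderedRing B] {h : B →ₚ[ℂ] ℂ} {ρ : HilbertRep B}
    {ζ : ρ.H} (hρ : ∀ b, h b = inner ℂ ζ (ρ.toHom b ζ)) (π : HilbertRep A) (ξ' ξ : π.H)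
    (x : SpatialTensor A B) :
    inner ℂ ξ' (π.toHom (sliceRight h x) ξ) =
      inner ℂ (vec ξ' ζ) ((rep π ρ).toHom x (vec ξ ζ)) := by
  change (π.coeff ξ' ξ ∘L sliceRight h) x = (rep π ρ).coeff _ _ x
  revert x
  refine DFunLike.congr_fun (clm_ext fun a b => ?_)
  rw [ContinuousLinearMap.comp_apply, HilbertRep.coeff_apply, HilbertRep.coeff_apply,
    sliceRight_tmul, inner_rep_tmul, map_smul, smul_apply, inner_smul_right,
    hρ, mul_comm]

theorem inner_sliceLeft [PartialOrder A] [StarOrderedRing A] {h : A →ₚ[ℂ] ℂ} {π : HilbertRep A}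
    {ζ : π.H} (hπ : ∀ a, h a = inner ℂ ζ (π.toHom a ζ)) (ρ : HilbertRep B) (ξ' ξ : ρ.H)
    (x : SpatialTensor A B) :
    inner ℂ ξ' (ρ.toHom (sliceLeft h x) ξ) =
      inner ℂ (vec ζ ξ') ((rep π ρ).toHom x (vec ζ ξ)) := by
  change (ρ.coeff ξ' ξ ∘L sliceLeft h) x = (rep π ρ).coeff _ _ x
  revert x
  refine DFunLike.congr_fun (clm_ext fun a b => ?_)
  rw [ContinuousLinearMap.comp_apply, HilbertRep.coeff_apply, HilbertRep.coeff_apply,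
    sliceLeft_tmul, inner_rep_tmul, map_smul, smul_apply, inner_smul_right,
    hπ]

theorem sliceRight_star [PartialOrder B] [StarOrderedRing B] (h : B →ₚ[ℂ] ℂ)
    (x : SpatialTensor A B) : sliceRight h (star x) = star (sliceRight h x) := by
  refine induction_algebraic (p := fun x => sliceRight h (star x) = star (sliceRight h x))
    (isClosed_eq (by fun_prop) (by fun_prop)) (fun t => ?_) x
  induction t with
  | zero => simp
  | add s t hs ht => simp only [map_add, star_add, hs, ht]
  | tmul a b =>
    change sliceRight h (star (tmul a b)) = star (sliceRight h (tmul a b))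
    rw [star_tmul, sliceRight_tmul, sliceRight_tmul, star_smul, map_star]

theorem sliceLeft_star [PartialOrder A] [StarOrderedRing A] (h : A →ₚ[ℂ] ℂ)
    (x : SpatialTensor A B) : sliceLeft h (star x) = star (sliceLeft h x) := by
  refine induction_algebraic (p := fun x => sliceLeft h (star x) = star (sliceLeft h x))
    (isClosed_eq (by fun_prop) (by fun_prop)) (fun t => ?_) x
  induction t with
  | zero => simp
  | add s t hs ht => simp only [map_add, star_add, hs, ht]
  | tmul a b =>
    change sliceLeft h (star (tmul a b)) = star (sliceLeft h (tmul a b))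
    rw [star_tmul, sliceLeft_tmul, sliceLeft_tmul, star_smul, map_star]

theorem inner_sliceLeft_vecFunctional [PartialOrder A] [StarOrderedRing A]
    (π : HilbertRep A) (ρ : HilbertRep B) (ξ : π.H)
    (η' η : ρ.H) (x : SpatialTensor A B) :
    inner ℂ η' (ρ.toHom (sliceLeft (π.vecFunctional ξ) x) η) =
      inner ℂ (vec ξ η') ((rep π ρ).toHom x (vec ξ η)) :=
  inner_sliceLeft (fun _ => rfl) ρ η' η x

/-- The left slice maps separate the points of the spatial tensor product. -/
theorem eq_zero_of_sliceLeft [PartialOrder A] [StarOrderedRing A] {x : SpatialTensor A B}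
    (h : ∀ F : A →ₚ[ℂ] ℂ, sliceLeft F x = 0) : x = 0 := by
  refine eq_zero_of_rep fun π ρ => ?_
  have diag : ∀ (ξ : π.H) (η' η : ρ.H),
      inner ℂ (vec ξ η') ((rep π ρ).toHom x (vec ξ η)) = 0 := fun ξ η' η => by
    rw [← inner_sliceLeft_vecFunctional, h]
    simp
  have offdiag : ∀ (ξ' ξ : π.H) (η' η : ρ.H),
      inner ℂ (vec ξ' η') ((rep π ρ).toHom x (vec ξ η)) = 0 := fun ξ' ξ η' η => by
    have h1 := diag (ξ' + ξ) η' η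
    have h2 := diag (ξ' + Complex.I • ξ) η' η
    simp only [vec_add_left, vec_smul_left, map_add, map_smul, inner_add_left, inner_add_right,
      inner_smul_left, inner_smul_right, diag, Complex.conj_I, zero_add, add_zero, mul_zero]
      at h1 h2
    linear_combination h1 / 2 - Complex.I / 2 * h2 +
      (inner ℂ (vec ξ' η') ((rep π ρ).toHom x (vec ξ η)) -
        inner ℂ (vec ξ η') ((rep π ρ).toHom x (vec ξ' η))) / 2 * Complex.I_sq
  refine ContinuousLinearMap.ext_on (span_vec_dense π ρ) ?_
  rintro _ ⟨ξ, η, rfl⟩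
  refine (span_vec_dense π ρ).eq_zero_of_inner_right ℂ fun v hv => ?_
  induction hv using Submodule.span_induction with
  | mem v hv =>
    obtain ⟨ξ', η', rfl⟩ := hv
    exact offdiag ξ' ξ η' η
  | zero => exact inner_zero_left _
  | add v w _ _ hv hw => rw [inner_add_left, hv, hw, add_zero]
  | smul r v _ hv => rw [inner_smul_left, hv, mul_zero]

variable [PartialOrder A] [StarOrderedRing A] [PartialOrder B] [StarOrderedRing B]

theorem sliceRight_nonneg (h : B →ₚ[ℂ] ℂ) (x : SpatialTensor A B) :
    0 ≤ sliceRight h (star x * x) := by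
  refine nonneg_of_forall_inner ?_ fun π ξ => ?_
  · rw [IsSelfAdjoint, ← sliceRight_star, star_mul, star_star]
  · rw [inner_sliceRight (fun b => (HilbertRep.inner_gns h b).symm) π]
    exact (rep π (HilbertRep.gns h)).isPositive_coeff _ x

theorem sliceLeft_nonneg (h : A →ₚ[ℂ] ℂ) (x : SpatialTensor A B) :
    0 ≤ sliceLeft h (star x * x) := by
  refine nonneg_of_forall_inner ?_ fun π ξ => ?_
  · rw [IsSelfAdjoint, ← sliceLeft_star, star_mul, star_star]
  · rw [inner_sliceLeft (fun b => (HilbertRep.inner_gns h b).symm) π]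
    exact (rep (HilbertRep.gns h) π).isPositive_coeff _ x

theorem apply_sliceLeft_eq (φ : A →ₚ[ℂ] ℂ) (h : B →ₚ[ℂ] ℂ) (x : SpatialTensor A B) :
    h (sliceLeft φ x) = φ (sliceRight h x) := by
  change (h.toDual ∘L sliceLeft φ) x = (φ.toDual ∘L sliceRight h) x
  refine DFunLike.congr_fun (clm_ext fun a b => ?_) x
  simp only [ContinuousLinearMap.comp_apply, sliceLeft_tmul, sliceRight_tmul, map_smul,
    PositiveLinearMap.toDual_apply, smul_eq_mul]
  rw [mul_comm]

/-- The right slice map of a faithful positive functional is faithful. -/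
theorem eq_zero_of_sliceRight {h : B →ₚ[ℂ] ℂ} (hh : ∀ b, h (star b * b) = 0 → b = 0)
    {x : SpatialTensor A B} (hx : sliceRight h (star x * x) = 0) : x = 0 := by
  refine eq_zero_of_rep_vec fun π ρ ξ η => ?_
  have h1 : h (sliceLeft (π.vecFunctional ξ) (star x * x)) = 0 := by
    rw [apply_sliceLeft_eq, hx, map_zero]
  obtain ⟨b, hb⟩ := CStarAlgebra.nonneg_iff_eq_star_mul_self.mp
    (sliceLeft_nonneg (π.vecFunctional ξ) x)
  rw [hb] at h1
  rw [hh b h1] at hb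
  have h3 := inner_sliceLeft_vecFunctional π ρ ξ η η (star x * x)
  rw [hb] at h3
  replace h3 := h3.trans ((rep π ρ).inner_toHom_star_mul_self (vec ξ η) x)
  rw [mul_zero, map_zero, zero_apply, inner_zero_right] at h3
  simpa using (Complex.ofReal_inj.mp (Complex.ofReal_zero.trans h3)).symm

end SpatialTensor
end

noncomputable section

namespace SpatialTensor

variable {A B C D : Type u} [CStarAlgebra A] [CStarAlgebra B] [CStarAlgebra C] [CStarAlgebra D]

theorem sliceRight_map [PartialOrder B] [StarOrderedRing B] (h : B →ₚ[ℂ] ℂ) (f : A →⋆ₐ[ℂ] D)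
    (x : SpatialTensor A B) :
    sliceRight h (map f (StarAlgHom.id ℂ B) x) = f (sliceRight h x) := by
  change (sliceRight h ∘L (map f (StarAlgHom.id ℂ B)).toCLM) x = (f.toCLM ∘L sliceRight h) x
  refine DFunLike.congr_fun (clm_ext fun a b => ?_) x
  simp only [ContinuousLinearMap.comp_apply, StarAlgHom.toCLM_apply, map_tmul, sliceRight_tmul,
    map_smul]
  rfl

theorem sliceLeft_map [PartialOrder A] [StarOrderedRing A] (h : A →ₚ[ℂ] ℂ) (f : B →⋆ₐ[ℂ] D)
    (x : SpatialTensor A B) :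
    sliceLeft h (map (StarAlgHom.id ℂ A) f x) = f (sliceLeft h x) := by
  change (sliceLeft h ∘L (map (StarAlgHom.id ℂ A) f).toCLM) x = (f.toCLM ∘L sliceLeft h) x
  refine DFunLike.congr_fun (clm_ext fun a b => ?_) x
  simp only [ContinuousLinearMap.comp_apply, StarAlgHom.toCLM_apply, map_tmul, sliceLeft_tmul,
    map_smul]
  rfl

theorem sliceLeft_sliceRight_of_mem_assocGraph [PartialOrder A] [StarOrderedRing A]
    [PartialOrder C] [StarOrderedRing C] (φ : A →ₚ[ℂ] ℂ) (h : C →ₚ[ℂ] ℂ)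
    {p : SpatialTensor (SpatialTensor A B) C × SpatialTensor A (SpatialTensor B C)}
    (hp : p ∈ assocGraph) :
    sliceLeft φ (sliceRight h p.1) = sliceRight h (sliceLeft φ p.2) := by
  let F : SpatialTensor (SpatialTensor A B) C × SpatialTensor A (SpatialTensor B C) →L[ℂ] B :=
    sliceLeft φ ∘L sliceRight h ∘L ContinuousLinearMap.fst ℂ _ _ -
      sliceRight h ∘L sliceLeft φ ∘L ContinuousLinearMap.snd ℂ _ _
  have hF : assocGraph ≤ LinearMap.ker F.toLinearMap := by
    refine Submodule.topologicalClosure_minimal _ (Submodule.span_le.mpr ?_)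
      (isClosed_singleton.preimage F.continuous)
    rintro _ ⟨⟨a, b, c⟩, rfl⟩
    change sliceLeft φ (sliceRight h (tmul (tmul a b) c)) -
      sliceRight h (sliceLeft φ (tmul a (tmul b c))) = 0
    rw [sliceRight_tmul, sliceLeft_tmul, map_smul, map_smul, sliceLeft_tmul, sliceRight_tmul,
      smul_comm, sub_self]
  exact sub_eq_zero.mp (hF hp)

end SpatialTensor

namespace CompactQuantumGroup.Action

open SpatialTensor

variable {A C : Type u} [CStarAlgebra A] [PartialOrder A] [StarOrderedRing A]
  [CStarAlgebra C] {G : CompactQuantumGroup A}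

/-- Averaging over the quantum group: `c ↦ (id ⊗ h) (δ c)`. -/
def average (δ : G.Action C) (h : A →ₚ[ℂ] ℂ) : C →L[ℂ] C := sliceRight h ∘L δ.toHom.toCLM

theorem average_apply (δ : G.Action C) (h : A →ₚ[ℂ] ℂ) (c : C) :
    δ.average h c = sliceRight h (δ.toHom c) := rfl

theorem average_mem_of_isInvariant (δ : G.Action C) (h : A →ₚ[ℂ] ℂ) {S : Submodule ℂ C}
    (hS : IsClosed (S : Set C)) (hinv : δ.IsInvariant (S : Set C)) {c : C} (hc : c ∈ S) :
    δ.average h c ∈ S := by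
  have hle : (Submodule.span ℂ {x | ∃ c ∈ (S : Set C), ∃ a : A, x = tmul c a}) ≤
      S.comap (sliceRight h : SpatialTensor C A →L[ℂ] C).toLinearMap := by
    refine Submodule.span_le.mpr ?_
    rintro _ ⟨c, hc, a, rfl⟩
    change sliceRight h (tmul c a) ∈ S
    rw [sliceRight_tmul]
    exact S.smul_mem _ hc
  exact closure_minimal hle (hS.preimage (sliceRight h).continuous) (hinv c hc)

variable [PartialOrder C] [StarOrderedRing C]

theorem average_mem_fixedPoints (δ : G.Action C) {h : A →ₚ[ℂ] ℂ} (hh : G.IsHaarState h) (c : C) :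
    δ.average h c ∈ δ.fixedPoints := by
  refine sub_eq_zero.mp (eq_zero_of_sliceLeft fun φ => ?_)
  have h1 := sliceLeft_sliceRight_of_mem_assocGraph φ h (δ.coassoc c)
  rw [sliceRight_map, sliceLeft_map, hh.right_invariant, apply_sliceLeft_eq] at h1
  rw [map_sub, average_apply, h1, sliceLeft_tmul, sub_self]

theorem average_nonneg (δ : G.Action C) (h : A →ₚ[ℂ] ℂ) {c : C} (hc : 0 ≤ c) :
    0 ≤ δ.average h c := by
  obtain ⟨b, rfl⟩ := CStarAlgebra.nonneg_iff_eq_star_mul_self.mp hc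
  rw [average_apply, map_mul, map_star]
  exact sliceRight_nonneg h _

theorem eq_zero_of_average_eq_zero (δ : G.Action C) (hδ : Function.Injective δ.toHom)
    {h : A →ₚ[ℂ] ℂ} (hh : ∀ a, h (star a * a) = 0 → a = 0) {c : C} (hc : 0 ≤ c)
    (h0 : δ.average h c = 0) : c = 0 := by
  obtain ⟨b, rfl⟩ := CStarAlgebra.nonneg_iff_eq_star_mul_self.mp hc
  rw [average_apply, map_mul, map_star] at h0
  have h1 := eq_zero_of_sliceRight hh h0
  rw [hδ (h1.trans (map_zero δ.toHom).symm), mul_zero]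

theorem IsErgodic.exists_average_eq {δ : G.Action C} (he : δ.IsErgodic) {h : A →ₚ[ℂ] ℂ}
    (hh : G.IsHaarState h) (c : C) : ∃ μ : ℂ, δ.average h c = μ • (1 : C) := by
  have h1 := δ.average_mem_fixedPoints hh c
  rw [IsErgodic] at he
  rw [he] at h1
  obtain ⟨μ, hμ⟩ := h1
  exact ⟨μ, by rw [← hμ, Algebra.algebraMap_eq_smul_one]⟩

theorem eq_bot_or_eq_top_of_isErgodic {δ : G.Action C} (he : δ.IsErgodic)
    (hδ : Function.Injective δ.toHom) {h : A →ₚ[ℂ] ℂ} (hh : G.IsHaarState h)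
    (hf : ∀ a, h (star a * a) = 0 → a = 0) (J : Ideal C) (hJ : IsClosed (J : Set C))
    (hinv : δ.IsInvariant (J : Set C)) : J = ⊥ ∨ J = ⊤ := by
  refine or_iff_not_imp_left.mpr fun hne => ?_
  obtain ⟨c, hc, hc0⟩ := Submodule.exists_mem_ne_zero_of_ne_bot hne
  let S : Submodule ℂ C := J.restrictScalars ℂ
  have h1 : δ.average h (star c * c) ∈ S :=
    δ.average_mem_of_isInvariant (S := S) h hJ hinv (J.mul_mem_left _ hc)
  obtain ⟨μ, hμ⟩ := he.exists_average_eq hh (star c * c)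
  have hμ0 : μ ≠ 0 := by
    rintro rfl
    rw [zero_smul] at hμ
    exact hc0 ((CStarRing.star_mul_self_eq_zero_iff _).mp
      (δ.eq_zero_of_average_eq_zero hδ hf (star_mul_self_nonneg c) hμ))
  refine (Ideal.eq_top_iff_one J).mpr ?_
  have h2 := S.smul_mem μ⁻¹ h1
  rwa [hμ, smul_smul, inv_mul_cancel₀ hμ0, one_smul] at h2

end CompactQuantumGroup.Action

section Hereditary

variable {C : Type u} [CStarAlgebra C] [PartialOrder C] [StarOrderedRing C]

theorem IsHereditary.eq_top_of_one_mem {B : NonUnitalStarSubalgebra ℂ C} (hB : IsHereditary B)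
    (h1 : (1 : C) ∈ B) : B = ⊤ := by
  have hpos : ∀ a : C, 0 ≤ a → a ∈ B := fun a ha => by
    refine hB a ((‖a‖ : ℂ) • 1) ha ?_ (SMulMemClass.smul_mem _ h1)
    have := CStarAlgebra.norm_le_iff_le_algebraMap a (norm_nonneg a) ha |>.mp le_rfl
    rwa [Algebra.algebraMap_eq_smul_one, ← Complex.coe_smul] at this
  refine top_le_iff.mp fun a _ => ?_
  have hle : Submodule.span ℂ {a : C | 0 ≤ a} ≤ B.toSubmodule := Submodule.span_le.mpr hpos
  rw [CStarAlgebra.span_nonneg] at hle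
  exact hle Submodule.mem_top

/-- The left ideal `{c | c⋆ c ∈ B}` of a hereditary C*-subalgebra `B`. -/
def IsHereditary.leftIdeal {B : NonUnitalStarSubalgebra ℂ C} (hB : IsHereditary B) : Ideal C where
  carrier := {c | star c * c ∈ B}
  zero_mem' := by simp
  add_mem' {c d} hc hd := by
    have hle : star (c + d) * (c + d) ≤ (2 : ℂ) • (star c * c + star d * d) := by
      rw [← sub_nonneg]
      have : (2 : ℂ) • (star c * c + star d * d) - star (c + d) * (c + d) =
          star (c - d) * (c - d) := by
        rw [two_smul, star_add, star_sub]; noncomm_ring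
      rw [this]
      exact star_mul_self_nonneg _
    exact hB _ _ (star_mul_self_nonneg _) hle
      (SMulMemClass.smul_mem _ (add_mem hc hd))
  smul_mem' x c hc := by
    have hx : star x * x ≤ (‖star x * x‖ : ℂ) • (1 : C) := by
      have := CStarAlgebra.norm_le_iff_le_algebraMap (star x * x) (norm_nonneg _)
        (star_mul_self_nonneg x) |>.mp le_rfl
      rwa [Algebra.algebraMap_eq_smul_one, ← Complex.coe_smul] at this
    have h1 := star_left_conjugate_le_conjugate hx c
    rw [mul_smul_comm, mul_one, smul_mul_assoc] at h1
    refine hB _ _ (star_mul_self_nonneg _) ?_ (SMulMemClass.smul_mem (‖star x * x‖ : ℂ) hc)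
    rw [smul_eq_mul, star_mul]
    simpa only [mul_assoc] using h1

end Hereditary
end

noncomputable section

namespace SpatialTensor

variable {A C : Type u} [CStarAlgebra A] [CStarAlgebra C]

variable (A) in
/-- The closed linear span of the elementary tensors `c ⊗ a` with `c ∈ S`. -/
def closedSpan (S : Set C) : Submodule ℂ (SpatialTensor C A) :=
  (Submodule.span ℂ {x | ∃ c ∈ S, ∃ a : A, x = tmul c a}).topologicalClosure

theorem isClosed_closedSpan (S : Set C) : IsClosed (closedSpan A S : Set (SpatialTensor C A)) :=
  Submodule.isClosed_topologicalClosure _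

theorem tmul_mem_closedSpan {S : Set C} {c : C} (hc : c ∈ S) (a : A) :
    tmul c a ∈ closedSpan A S :=
  Submodule.le_topologicalClosure _ (Submodule.subset_span ⟨c, hc, a, rfl⟩)

theorem closedSpan_le {S : Set C} {T : Submodule ℂ (SpatialTensor C A)}
    (hT : IsClosed (T : Set (SpatialTensor C A))) (h : ∀ c ∈ S, ∀ a : A, tmul c a ∈ T) :
    closedSpan A S ≤ T := by
  refine Submodule.topologicalClosure_minimal _ (Submodule.span_le.mpr ?_) hT
  rintro _ ⟨c, hc, a, rfl⟩
  exact h c hc a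

theorem closedSpan_univ : closedSpan A (Set.univ : Set C) = ⊤ := by
  refine top_le_iff.mp fun x _ => ?_
  refine induction_algebraic (p := fun x => x ∈ closedSpan A (Set.univ : Set C))
    (isClosed_closedSpan _) (fun t => ?_) x
  induction t with
  | zero => rw [map_zero]; exact Submodule.zero_mem _
  | add s t hs ht => rw [map_add]; exact Submodule.add_mem _ hs ht
  | tmul c a => exact tmul_mem_closedSpan (Set.mem_univ c) a

theorem closedSpan_mono {S T : Set C} (h : S ⊆ T) : closedSpan A S ≤ closedSpan A T :=
  closedSpan_le (isClosed_closedSpan T) fun _ hc a => tmul_mem_closedSpan (h hc) a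

/-- A bounded linear endomorphism of `C ⊗ A` acting on elementary tensors through `C` and `A` maps
everything into `S ⊗ A` as soon as it maps the elementary tensors into it. -/
theorem apply_mem_closedSpan {R S : Set C} (F : SpatialTensor C A →L[ℂ] SpatialTensor C A)
    (h : ∀ c ∈ R, ∀ a, F (tmul c a) ∈ closedSpan A S) {x : SpatialTensor C A}
    (hx : x ∈ closedSpan A R) : F x ∈ closedSpan A S :=
  closedSpan_le (T := (closedSpan A S).comap F.toLinearMap)
    ((isClosed_closedSpan S).preimage F.continuous) h hx

theorem mul_mem_closedSpan (J : Ideal C) (x : SpatialTensor C A) {y : SpatialTensor C A}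
    (hy : y ∈ closedSpan A (J : Set C)) : x * y ∈ closedSpan A (J : Set C) := by
  have hx : x ∈ closedSpan A (Set.univ : Set C) :=
    closedSpan_univ (A := A) (C := C) ▸ Submodule.mem_top
  refine apply_mem_closedSpan ((ContinuousLinearMap.mul ℂ (SpatialTensor C A)).flip y)
    (fun c _ a => ?_) hx
  refine apply_mem_closedSpan (ContinuousLinearMap.mul ℂ (SpatialTensor C A) (tmul c a))
    (fun d hd b => ?_) hy
  rw [ContinuousLinearMap.mul_apply', tmul_mul_tmul]
  exact tmul_mem_closedSpan (J.mul_mem_left c hd) _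

end SpatialTensor

namespace CompactQuantumGroup.Action

open SpatialTensor

variable {A C : Type u} [CStarAlgebra A] [CStarAlgebra C] {G : CompactQuantumGroup A}

theorem isInvariant_iff (δ : G.Action C) (S : Set C) :
    δ.IsInvariant S ↔ ∀ s ∈ S, δ.toHom s ∈ closedSpan A S := Iff.rfl

theorem isInvariant_closure_span (δ : G.Action C) {S : Set C} (hS : δ.IsInvariant S) :
    δ.IsInvariant ((Ideal.span S).closure : Set C) := by
  have hsub : S ⊆ ((Ideal.span S).closure : Set C) :=
    Ideal.subset_span.trans subset_closure
  rw [isInvariant_iff]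
  refine closure_minimal (t := δ.toHom ⁻¹' (closedSpan A
    ((Ideal.span S).closure : Set C) : Set (SpatialTensor C A))) (fun s hs => ?_)
    ((isClosed_closedSpan _).preimage δ.toHom.continuous_coe)
  change δ.toHom s ∈ closedSpan A _
  induction hs using Submodule.span_induction with
  | mem s hs => exact closedSpan_mono hsub (hS s hs)
  | zero => rw [map_zero]; exact Submodule.zero_mem _
  | add s t _ _ hs ht => rw [map_add]; exact Submodule.add_mem _ hs ht
  | smul c s _ hs =>
    rw [smul_eq_mul, map_mul]
    exact mul_mem_closedSpan _ _ hs

variable [PartialOrder C] [StarOrderedRing C]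

theorem hereditary_eq_bot_or_eq_top (δ : G.Action C)
    (hJ : ∀ J : Ideal C, IsClosed (J : Set C) → δ.IsInvariant (J : Set C) → J = ⊥ ∨ J = ⊤)
    (B : NonUnitalStarSubalgebra ℂ C) (hB : IsClosed (B : Set C)) (hher : IsHereditary B)
    (hinv : δ.IsInvariant (B : Set C)) : B = ⊥ ∨ B = ⊤ := by
  rcases hJ (Ideal.span (B : Set C)).closure isClosed_closure (δ.isInvariant_closure_span hinv)
    with h | h
  · refine .inl (eq_bot_iff.mpr fun b hb => ?_)
    have h1 : b ∈ (Ideal.span (B : Set C)).closure := subset_closure (Ideal.subset_span hb)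
    rw [h] at h1
    exact NonUnitalStarAlgebra.mem_bot.mpr ((Submodule.mem_bot _).mp h1)
  · refine .inr (hher.eq_top_of_one_mem ?_)
    have hle : Ideal.span (B : Set C) ≤ hher.leftIdeal :=
      Ideal.span_le.mpr fun b hb => mul_mem (star_mem hb) hb
    have hcl : IsClosed (hher.leftIdeal : Set C) :=
      hB.preimage (continuous_star.mul continuous_id)
    have h1 : (1 : C) ∈ hher.leftIdeal :=
      closure_minimal hle hcl (h ▸ Submodule.mem_top : (1 : C) ∈ (Ideal.span (B : Set C)).closure)
    have h2 : star (1 : C) * 1 ∈ B := h1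
    rwa [star_one, one_mul] at h2

end CompactQuantumGroup.Action

section ApproximateUnit

variable {C : Type u} [CStarAlgebra C] [PartialOrder C] [StarOrderedRing C]

theorem continuousOn_inv_add {f : C} (hf : 0 ≤ f) (n : ℕ) :
    ContinuousOn (fun t : ℝ => (t + 1 / (n + 1 : ℝ))⁻¹) (spectrum ℝ f) := by
  refine ContinuousOn.inv₀ (by fun_prop) fun t ht => ?_
  have := spectrum_nonneg_of_nonneg hf ht
  positivity

/-- The element `f (f + 1/(n+1))⁻¹`. -/
def approxUnit (f : C) (n : ℕ) : C := cfc (fun t : ℝ => t * (t + 1 / (n + 1 : ℝ))⁻¹) f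

theorem approxUnit_nonneg {f : C} (hf : 0 ≤ f) (n : ℕ) : 0 ≤ approxUnit f n :=
  cfc_nonneg fun t ht => by
    have := spectrum_nonneg_of_nonneg hf ht
    positivity

theorem approxUnit_le_one {f : C} (hf : 0 ≤ f) (n : ℕ) : approxUnit f n ≤ 1 :=
  cfc_le_one _ _ fun t ht => by
    have := spectrum_nonneg_of_nonneg hf ht
    rw [← div_eq_mul_inv, div_le_one (by positivity)]
    have : 0 ≤ 1 / (n + 1 : ℝ) := by positivity
    linarith

theorem approxUnit_monotone {f : C} (hf : 0 ≤ f) : Monotone (approxUnit f) := by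
  intro m n hmn
  have hm := continuousOn_inv_add hf m
  have hn := continuousOn_inv_add hf n
  refine cfc_mono fun t ht => ?_
  have ht := spectrum_nonneg_of_nonneg hf ht
  have h1 : 1 / (n + 1 : ℝ) ≤ 1 / (m + 1 : ℝ) := by gcongr
  gcongr

theorem exists_approxUnit_eq {f : C} (hf : 0 ≤ f) (n : ℕ) :
    ∃ k : C, approxUnit f n = f * k ∧ approxUnit f n = k * f := by
  have hn := continuousOn_inv_add hf n
  refine ⟨cfc (fun t : ℝ => (t + 1 / (n + 1 : ℝ))⁻¹) f, ?_, ?_⟩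
  · rw [approxUnit, cfc_mul (fun t => t) _ f, cfc_id' ℝ f]
  · rw [approxUnit, cfc_congr (g := fun t : ℝ => (t + 1 / (n + 1 : ℝ))⁻¹ * t)
      fun t _ => mul_comm _ _, cfc_mul _ (fun t => t) f, cfc_id' ℝ f]

theorem norm_one_sub_approxUnit_mul_le {f : C} (hf : 0 ≤ f) (n : ℕ) :
    ‖(1 - approxUnit f n) * f‖ ≤ 1 / (n + 1 : ℝ) := by
  have hn := continuousOn_inv_add hf n
  have h1 : (1 - approxUnit f n) * f =
      cfc (fun t : ℝ => (1 - t * (t + 1 / (n + 1 : ℝ))⁻¹) * t) f := by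
    rw [cfc_mul _ (fun t => t) f, cfc_id' ℝ f, cfc_sub _ _ f, cfc_const_one ℝ f, approxUnit]
  rw [h1]
  refine norm_cfc_le (by positivity) fun t ht => ?_
  have ht := spectrum_nonneg_of_nonneg hf ht
  have hpos : 0 < t + 1 / (n + 1 : ℝ) := by positivity
  have h2 : (1 - t * (t + 1 / (n + 1 : ℝ))⁻¹) * t =
      1 / (n + 1 : ℝ) * (t / (t + 1 / (n + 1 : ℝ))) := by
    generalize 1 / (n + 1 : ℝ) = s at hpos ⊢
    field_simp
    ring
  rw [h2, Real.norm_of_nonneg (by positivity)]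
  refine mul_le_of_le_one_right (by positivity) ((div_le_one hpos).mpr ?_)
  have : 0 ≤ 1 / (n + 1 : ℝ) := by positivity
  linarith

theorem tendsto_approxUnit_mul {f : C} (hf : 0 ≤ f) :
    Filter.Tendsto (fun n => approxUnit f n * f) Filter.atTop (nhds f) := by
  have h : Filter.Tendsto (fun n => (1 - approxUnit f n) * f) Filter.atTop (nhds 0) :=
    squeeze_zero_norm (norm_one_sub_approxUnit_mul_le hf) tendsto_one_div_add_atTop_nhds_zero_nat
  simpa [sub_mul] using h.const_sub f

theorem tendsto_mul_approxUnit {f : C} (hf : 0 ≤ f) :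
    Filter.Tendsto (fun n => f * approxUnit f n) Filter.atTop (nhds f) := by
  have h := (tendsto_approxUnit_mul hf).star
  simpa only [star_mul, (IsSelfAdjoint.of_nonneg hf).star_eq,
    (IsSelfAdjoint.of_nonneg (approxUnit_nonneg hf _)).star_eq] using h

end ApproximateUnit
end

noncomputable section

namespace CompactQuantumGroup.Action

open SpatialTensor

variable {A C : Type u} [CStarAlgebra A] [CStarAlgebra C] {G : CompactQuantumGroup A}

theorem mem_fixedPoints_iff (δ : G.Action C) {c : C} :
    c ∈ δ.fixedPoints ↔ δ.toHom c = inl C A c := Iff.rfl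

theorem cfc_mem_fixedPoints (δ : G.Action C) {x : C} (hx : IsSelfAdjoint x)
    (h : x ∈ δ.fixedPoints) (f : ℝ → ℝ) (hf : ContinuousOn f (spectrum ℝ x)) :
    cfc f x ∈ δ.fixedPoints := by
  rw [mem_fixedPoints_iff] at h ⊢
  rw [StarAlgHom.map_cfc (S := ℂ) δ.toHom f x hf δ.toHom.continuous_coe hx (hx.map δ.toHom),
    StarAlgHom.map_cfc (S := ℂ) (inl C A) f x hf (inl C A).continuous_coe hx (hx.map (inl C A)), h]

theorem exists_isSelfAdjoint_of_not_isErgodic (δ : G.Action C) (hδ : ¬ δ.IsErgodic) :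
    ∃ x ∈ δ.fixedPoints, IsSelfAdjoint x ∧ x ∉ Set.range (algebraMap ℂ C) := by
  by_contra! hall
  refine hδ (Set.Subset.antisymm (fun c hc => ?_) ?_)
  · have hcs : star c ∈ δ.fixedPoints := by
      rw [mem_fixedPoints_iff] at hc ⊢
      rw [map_star, map_star, hc]
    have h1 : c + star c ∈ δ.fixedPoints := by
      rw [mem_fixedPoints_iff] at hc hcs ⊢
      rw [map_add, map_add, hc, hcs]
    have h2 : Complex.I • (c - star c) ∈ δ.fixedPoints := by
      rw [mem_fixedPoints_iff] at hc hcs ⊢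
      rw [map_smul, map_smul, map_sub, map_sub, hc, hcs]
    obtain ⟨r, hr⟩ := hall _ h1 (IsSelfAdjoint.add_star_self c)
    obtain ⟨s, hs⟩ := hall _ h2 (by
      rw [IsSelfAdjoint, star_smul, star_sub, star_star, ← neg_sub c, Complex.star_def,
        Complex.conj_I, neg_smul_neg])
    refine ⟨(r - Complex.I * s) / 2, ?_⟩
    rw [Algebra.algebraMap_eq_smul_one] at hr hs ⊢
    have : ((r - Complex.I * s) / 2) • (1 : C) =
        (1 / 2 : ℂ) • (r • (1 : C)) - (Complex.I / 2) • (s • (1 : C)) := by module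
    rw [this, hr, hs, smul_smul,
      show Complex.I / 2 * Complex.I = -(1 / 2) by linear_combination Complex.I_sq / 2]
    module
  · rintro _ ⟨r, rfl⟩
    rw [mem_fixedPoints_iff, AlgHomClass.commutes, AlgHomClass.commutes]

variable [PartialOrder C] [StarOrderedRing C]

theorem exists_orthogonal_of_not_isErgodic (δ : G.Action C) (hδ : ¬ δ.IsErgodic) :
    ∃ f g : C, 0 ≤ f ∧ f ≠ 0 ∧ g ≠ 0 ∧ f * g = 0 ∧ f ∈ δ.fixedPoints := by
  obtain ⟨x, hfix, hx, hns⟩ := δ.exists_isSelfAdjoint_of_not_isErgodic hδ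
  have hnt : Nontrivial C := by
    by_contra h
    rw [not_nontrivial_iff_subsingleton] at h
    exact hns ⟨0, Subsingleton.elim _ _⟩
  obtain ⟨s, hs, t, ht, hst⟩ : ∃ s ∈ spectrum ℝ x, ∃ t ∈ spectrum ℝ x, s < t := by
    obtain ⟨s, hs⟩ := ContinuousFunctionalCalculus.spectrum_nonempty (R := ℝ) x hx
    by_contra! hall
    refine hns ⟨(s : ℂ), ?_⟩
    rw [CFC.eq_algebraMap_of_spectrum_subset_singleton x s
      (fun t ht => le_antisymm (hall s hs t ht) (hall t ht s hs)) hx]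
    rw [Algebra.algebraMap_eq_smul_one, Algebra.algebraMap_eq_smul_one, Complex.coe_smul]
  have hne : ∀ F : ℝ → ℝ, Continuous F → (∃ r ∈ spectrum ℝ x, F r ≠ 0) → cfc F x ≠ 0 := by
    rintro F hF ⟨r, hr, hFr⟩ h0
    have h1 := cfc_map_spectrum F x hx hF.continuousOn
    rw [h0, spectrum.zero_eq] at h1
    exact hFr (h1.symm ▸ Set.mem_image_of_mem F hr : F r ∈ ({0} : Set ℝ))
  let m := (s + t) / 2
  refine ⟨cfc (fun r => max (r - m) 0) x, cfc (fun r => max (m - r) 0) x,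
    cfc_nonneg fun r _ => le_max_right _ _, hne _ (by fun_prop) ⟨t, ht, ?_⟩,
    hne _ (by fun_prop) ⟨s, hs, ?_⟩, ?_, δ.cfc_mem_fixedPoints hx hfix _ (by fun_prop)⟩
  · exact (lt_max_of_lt_left (by simp only [m]; linarith)).ne'
  · exact (lt_max_of_lt_left (by simp only [m]; linarith)).ne'
  · rw [← cfc_mul _ _ x, cfc_congr (g := fun _ => 0), cfc_const_zero]
    intro r _
    rcases le_total r m with h | h
    · simp [h]
    · simp [h]

end CompactQuantumGroup.Action

section Corner

variable {C : Type u} [CStarAlgebra C]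

/-- The `*`-subalgebra `f C f` of a self-adjoint element `f`. -/
def corner {f : C} (hf : IsSelfAdjoint f) : NonUnitalStarSubalgebra ℂ C where
  carrier := {b | ∃ c, b = f * c * f}
  add_mem' := by
    rintro _ _ ⟨c, rfl⟩ ⟨d, rfl⟩
    exact ⟨c + d, by rw [mul_add, add_mul]⟩
  zero_mem' := ⟨0, by simp⟩
  mul_mem' := by
    rintro _ _ ⟨c, rfl⟩ ⟨d, rfl⟩
    exact ⟨c * f * (f * d), by simp only [mul_assoc]⟩
  smul_mem' := by
    rintro r _ ⟨c, rfl⟩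
    exact ⟨r • c, by rw [mul_smul_comm, smul_mul_assoc]⟩
  star_mem' := by
    rintro _ ⟨c, rfl⟩
    exact ⟨star c, by rw [star_mul, star_mul, hf.star_eq, mul_assoc]⟩

theorem mem_corner {f : C} (hf : IsSelfAdjoint f) {b : C} :
    b ∈ corner hf ↔ ∃ c, b = f * c * f := Iff.rfl

variable [PartialOrder C] [StarOrderedRing C]

theorem tendsto_one_sub_approxUnit_mul {f : C} (hf : 0 ≤ f) {b : C}
    (hb : b ∈ (corner (IsSelfAdjoint.of_nonneg hf)).topologicalClosure) :
    Filter.Tendsto (fun n => (1 - approxUnit f n) * b) Filter.atTop (nhds 0) := by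
  have hnorm : ∀ n, ‖1 - approxUnit f n‖ ≤ 1 := fun n =>
    CStarAlgebra.norm_le_one_iff_of_nonneg _ (sub_nonneg.mpr (approxUnit_le_one hf n)) |>.mpr
      (sub_le_self _ (approxUnit_nonneg hf n))
  rw [Metric.tendsto_atTop]
  intro ε hε
  obtain ⟨_, ⟨c, rfl⟩, hbc⟩ := Metric.mem_closure_iff.mp hb (ε / 2) (half_pos hε)
  have h1 : Filter.Tendsto (fun n => (1 - approxUnit f n) * (f * c * f)) Filter.atTop (nhds 0) := by
    have := ((tendsto_approxUnit_mul hf).const_sub f).mul_const (c * f)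
    simpa [sub_mul, mul_assoc] using this
  obtain ⟨N, hN⟩ := Metric.tendsto_atTop.mp h1 (ε / 2) (half_pos hε)
  refine ⟨N, fun n hn => ?_⟩
  have h2 := hN n hn
  rw [dist_zero_right] at h2 ⊢
  rw [dist_eq_norm] at hbc
  calc ‖(1 - approxUnit f n) * b‖
      = ‖(1 - approxUnit f n) * (b - f * c * f) + (1 - approxUnit f n) * (f * c * f)‖ := by
        rw [← mul_add, sub_add_cancel]
    _ ≤ ‖1 - approxUnit f n‖ * ‖b - f * c * f‖ + ‖(1 - approxUnit f n) * (f * c * f)‖ :=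
        (norm_add_le _ _).trans (add_le_add_left (norm_mul_le _ _) _)
    _ ≤ 1 * ‖b - f * c * f‖ + ‖(1 - approxUnit f n) * (f * c * f)‖ := by
        gcongr
        exact hnorm n
    _ < ε := by linarith

theorem isHereditary_closure_corner {f : C} (hf : 0 ≤ f) :
    IsHereditary (corner (IsSelfAdjoint.of_nonneg hf)).topologicalClosure := by
  intro a b ha hab hb
  obtain ⟨d, rfl⟩ := CStarAlgebra.nonneg_iff_eq_star_mul_self.mp ha
  have hnorm : ∀ n, ‖1 - approxUnit f n‖ ≤ 1 := fun n =>
    CStarAlgebra.norm_le_one_iff_of_nonneg _ (sub_nonneg.mpr (approxUnit_le_one hf n)) |>.mpr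
      (sub_le_self _ (approxUnit_nonneg hf n))
  have hsa : ∀ n, star (1 - approxUnit f n) = 1 - approxUnit f n := fun n =>
    (IsSelfAdjoint.of_nonneg (sub_nonneg.mpr (approxUnit_le_one hf n))).star_eq
  have hbound : ∀ n, ‖d * (1 - approxUnit f n)‖ ^ 2 ≤ ‖(1 - approxUnit f n) * b‖ := fun n => by
    have h1 := star_left_conjugate_le_conjugate hab (1 - approxUnit f n)
    have h2 : star (1 - approxUnit f n) * (star d * d) * (1 - approxUnit f n) =
        star (d * (1 - approxUnit f n)) * (d * (1 - approxUnit f n)) := by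
      rw [star_mul]; simp only [mul_assoc]
    rw [h2] at h1
    have h3 := CStarAlgebra.norm_le_norm_of_nonneg_of_le (star_mul_self_nonneg _) h1
    rw [CStarRing.norm_star_mul_self, ← sq, hsa] at h3
    refine h3.trans ((norm_mul_le _ _).trans ?_)
    exact mul_le_of_le_one_right (norm_nonneg _) (hnorm n)
  have h0 : Filter.Tendsto (fun n => d * (1 - approxUnit f n)) Filter.atTop (nhds 0) := by
    rw [tendsto_zero_iff_norm_tendsto_zero]
    have h1 := squeeze_zero (fun n => sq_nonneg _) hbound
      (tendsto_zero_iff_norm_tendsto_zero.mp (tendsto_one_sub_approxUnit_mul hf hb))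
    have h2 := (Real.continuous_sqrt.tendsto 0).comp h1
    simpa [Function.comp_def] using h2
  have h1 : Filter.Tendsto (fun n => d * approxUnit f n) Filter.atTop (nhds d) := by
    simpa [mul_sub] using h0.const_sub d
  have h2 := h1.star.mul h1
  refine mem_closure_of_tendsto h2 (Filter.Eventually.of_forall fun n => ?_)
  obtain ⟨k, hk1, hk2⟩ := exists_approxUnit_eq hf n
  refine ⟨k * (star d * d) * k, ?_⟩
  rw [star_mul, (IsSelfAdjoint.of_nonneg (approxUnit_nonneg hf n)).star_eq]
  nth_rewrite 1 [hk1]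
  rw [hk2]
  simp only [mul_assoc]

end Corner

namespace CompactQuantumGroup.Action

open SpatialTensor

variable {A C : Type u} [CStarAlgebra A] [CStarAlgebra C] {G : CompactQuantumGroup A}

theorem isInvariant_closure_corner (δ : G.Action C) {f : C} (hf : IsSelfAdjoint f)
    (hfix : f ∈ δ.fixedPoints) : δ.IsInvariant ((corner hf).topologicalClosure : Set C) := by
  have hsub : (corner hf : Set C) ⊆ (corner hf).topologicalClosure := subset_closure
  rw [isInvariant_iff]
  refine closure_minimal (t := δ.toHom ⁻¹' (closedSpan A
    ((corner hf).topologicalClosure : Set C) : Set (SpatialTensor C A))) ?_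
    ((isClosed_closedSpan _).preimage δ.toHom.continuous_coe)
  rintro _ ⟨c, rfl⟩
  change δ.toHom _ ∈ closedSpan A _
  rw [map_mul, map_mul, show δ.toHom f = tmul f 1 from hfix]
  refine closedSpan_mono hsub ?_
  refine apply_mem_closedSpan (R := Set.univ)
    ((ContinuousLinearMap.mul ℂ (SpatialTensor C A)).flip (tmul f 1) ∘L
      ContinuousLinearMap.mul ℂ (SpatialTensor C A) (tmul f 1)) (fun c _ a => ?_)
    (x := δ.toHom c) (closedSpan_univ (A := A) (C := C) ▸ Submodule.mem_top)
  change tmul f 1 * tmul c a * tmul f 1 ∈ _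
  rw [tmul_mul_tmul, tmul_mul_tmul]
  exact tmul_mem_closedSpan (S := (corner hf : Set C)) ((mem_corner hf).mpr ⟨c, rfl⟩) _

theorem isErgodic_of_hereditary [PartialOrder C] [StarOrderedRing C] (δ : G.Action C)
    (h : ∀ B : NonUnitalStarSubalgebra ℂ C, IsClosed (B : Set C) → IsHereditary B →
      δ.IsInvariant (B : Set C) → B = ⊥ ∨ B = ⊤) : δ.IsErgodic := by
  by_contra hδ
  obtain ⟨f, g, hf, hf0, hg0, hfg, hfix⟩ := δ.exists_orthogonal_of_not_isErgodic hδ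
  have hsa := IsSelfAdjoint.of_nonneg hf
  rcases h (corner hsa).topologicalClosure isClosed_closure (isHereditary_closure_corner hf)
    (δ.isInvariant_closure_corner hsa hfix) with hB | hB
  · have h1 : star f * f ∈ (corner hsa).topologicalClosure :=
      subset_closure ⟨1, by rw [hsa.star_eq, mul_one]⟩
    rw [hB] at h1
    exact hf0 ((CStarRing.star_mul_self_eq_zero_iff f).mp (NonUnitalStarAlgebra.mem_bot.mp h1))
  · have h1 : (1 : C) ∈ (corner hsa).topologicalClosure := hB ▸ NonUnitalStarAlgebra.mem_top
    have h2 : (1 : C) ∈ {b : C | b * g = 0} :=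
      closure_minimal (s := (corner hsa : Set C)) (by
        rintro _ ⟨c, rfl⟩
        change f * c * f * g = 0
        rw [mul_assoc, hfg, mul_zero]) (isClosed_eq (by fun_prop) continuous_const) h1
    exact hg0 (by simpa using h2)

end CompactQuantumGroup.Action
end

noncomputable section

open Filter

/-- A sequence of reals converges if all finite sums of its increments are uniformly bounded. -/
theorem exists_tendsto_of_abs_sum_le (r : ℕ → ℝ) (M : ℝ)
    (h : ∀ s : Finset ℕ, |∑ k ∈ s, (r (k + 1) - r k)| ≤ M) :
    ∃ l, Tendsto r atTop (nhds l) := by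
  have hs : Summable fun k => r (k + 1) - r k := by
    refine Summable.of_abs (summable_of_sum_le (c := 2 * M) (fun _ => abs_nonneg _) fun s => ?_)
    rw [← Finset.sum_filter_add_sum_filter_not s (fun k => 0 ≤ r (k + 1) - r k)]
    have h1 := (le_abs_self _).trans (h (s.filter fun k => 0 ≤ r (k + 1) - r k))
    have h2 := (neg_le_abs _).trans (h (s.filter fun k => ¬ 0 ≤ r (k + 1) - r k))
    rw [← Finset.sum_neg_distrib] at h2
    rw [Finset.sum_congr rfl fun k hk => abs_of_nonneg (Finset.mem_filter.mp hk).2,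
      Finset.sum_congr (s₁ := s.filter fun k => ¬ 0 ≤ r (k + 1) - r k) rfl fun k hk =>
        abs_of_neg (not_le.mp (Finset.mem_filter.mp hk).2)]
    linarith
  refine ⟨∑' k, (r (k + 1) - r k) + r 0, ?_⟩
  have := hs.hasSum.tendsto_sum_nat.add_const (r 0)
  simpa only [Finset.sum_range_sub, sub_add_cancel] using this

section Monotone

variable {C : Type u} [CStarAlgebra C] [PartialOrder C] [StarOrderedRing C]

/-- Every bounded functional converges along a bounded increasing sequence of positive elements. -/
theorem exists_tendsto_of_monotone {e : ℕ → C} (he : Monotone e) (h0 : ∀ n, 0 ≤ e n)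
    (h1 : ∀ n, e n ≤ 1) (φ : StrongDual ℂ C) :
    ∃ l, Tendsto (fun n => φ (e n)) atTop (nhds l) := by
  have hnorm : ∀ s : Finset ℕ, ‖∑ k ∈ s, (e (k + 1) - e k)‖ ≤ 1 := fun s => by
    have hd : ∀ k, 0 ≤ e (k + 1) - e k := fun k => sub_nonneg.mpr (he k.le_succ)
    refine (CStarAlgebra.norm_le_one_iff_of_nonneg _ (Finset.sum_nonneg fun k _ => hd k)).mpr ?_
    obtain ⟨n, hn⟩ := s.exists_nat_subset_range
    calc ∑ k ∈ s, (e (k + 1) - e k) ≤ ∑ k ∈ Finset.range n, (e (k + 1) - e k) :=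
          Finset.sum_le_sum_of_subset_of_nonneg hn fun k _ _ => hd k
      _ = e n - e 0 := Finset.sum_range_sub e n
      _ ≤ e n := sub_le_self _ (h0 0)
      _ ≤ 1 := h1 n
  have hφ : ∀ s : Finset ℕ, ‖∑ k ∈ s, (φ (e (k + 1)) - φ (e k))‖ ≤ ‖φ‖ := fun s => by
    have : ∑ k ∈ s, (φ (e (k + 1)) - φ (e k)) = φ (∑ k ∈ s, (e (k + 1) - e k)) := by
      rw [map_sum]; simp only [map_sub]
    rw [this]
    exact φ.le_of_opNorm_le_of_le le_rfl (hnorm s) |>.trans_eq (mul_one _)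
  obtain ⟨a, ha⟩ := exists_tendsto_of_abs_sum_le (fun n => (φ (e n)).re) ‖φ‖ fun s => by
    refine le_trans ?_ ((Complex.abs_re_le_norm _).trans (hφ s))
    rw [Complex.re_sum]; simp only [Complex.sub_re, le_refl]
  obtain ⟨b, hb⟩ := exists_tendsto_of_abs_sum_le (fun n => (φ (e n)).im) ‖φ‖ fun s => by
    refine le_trans ?_ ((Complex.abs_im_le_norm _).trans (hφ s))
    rw [Complex.im_sum]; simp only [Complex.sub_im, le_refl]
  exact ⟨a + b * Complex.I, by
    simpa only [Function.comp_apply, Complex.re_add_im] using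
      ((Complex.continuous_ofReal.tendsto a).comp ha).add
        (((Complex.continuous_ofReal.tendsto b).comp hb).mul_const Complex.I)⟩

theorem exists_envelopingVN_tendsto {e : ℕ → C} (he : Monotone e) (h0 : ∀ n, 0 ≤ e n)
    (h1 : ∀ n, e n ≤ 1) :
    ∃ p : EnvelopingVN C, ∀ φ : StrongDual ℂ C, Tendsto (fun n => φ (e n)) atTop (nhds (p φ)) := by
  choose l hl using exists_tendsto_of_monotone he h0 h1
  refine ⟨continuousLinearMapOfTendsto (fun n => NormedSpace.inclusionInDoubleDual ℂ C (e n))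
    (f := l) (tendsto_pi_nhds.mpr fun φ => hl φ), fun φ => hl φ⟩

open EnvelopingVN in
theorem isProjection_of_tendsto {e : ℕ → C} (h0 : ∀ n, 0 ≤ e n)
    (hmul : ∀ n, Tendsto (fun m => e n * e m) atTop (nhds (e n))) {p : EnvelopingVN C}
    (hp : ∀ φ : StrongDual ℂ C, Tendsto (fun n => φ (e n)) atTop (nhds (p φ))) :
    IsProjection p where
  idempotent := by
    ext φ
    rw [mul_apply]
    refine tendsto_nhds_unique (hp (rightAct p φ)) ((hp φ).congr fun n => ?_)
    rw [rightAct_apply]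
    exact tendsto_nhds_unique ((φ.continuous.tendsto _).comp (hmul n))
      (hp (φ ∘L ContinuousLinearMap.mul ℂ C (e n)))
  selfAdjoint φ := by
    refine tendsto_nhds_unique (hp (adjFunctional φ)) ((hp φ).star.congr fun n => ?_)
    rw [adjFunctional_apply, (IsSelfAdjoint.of_nonneg (h0 n)).star_eq]

open EnvelopingVN in
theorem isOpenProjection_of_tendsto {e : ℕ → C} (he : Monotone e) (h0 : ∀ n, 0 ≤ e n)
    (hmul : ∀ n, Tendsto (fun m => e n * e m) atTop (nhds (e n))) {p : EnvelopingVN C}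
    (hp : ∀ φ : StrongDual ℂ C, Tendsto (fun n => φ (e n)) atTop (nhds (p φ))) :
    IsOpenProjection p := by
  refine ⟨isProjection_of_tendsto h0 hmul hp, ULift ℕ, inferInstance, inferInstance, inferInstance,
    fun n => e n.down, fun m n h => he h, fun n => h0 n.down, fun φ => (hp φ).comp ?_⟩
  exact Monotone.tendsto_atTop_atTop (fun m n h => h) fun n => ⟨⟨n⟩, le_rfl⟩

end Monotone

namespace CompactQuantumGroup.Action

variable {A C : Type u} [CStarAlgebra A] [CStarAlgebra C] [PartialOrder C] [StarOrderedRing C]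
  {G : CompactQuantumGroup A}

open EnvelopingVN SpatialTensor in
theorem isErgodic_of_isOpenProjection (δ : G.Action C)
    (h : ∀ p : EnvelopingVN C, IsOpenProjection p →
      le (map δ.toHom p) (map (inl C A) p) → p = 0 ∨ p = unit C) : δ.IsErgodic := by
  by_contra hδ
  obtain ⟨f, g, hf, hf0, hg0, hfg, hfix⟩ := δ.exists_orthogonal_of_not_isErgodic hδ
  have hpos := approxUnit_nonneg hf
  obtain ⟨p, hp⟩ := exists_envelopingVN_tendsto (approxUnit_monotone hf) hpos
    (approxUnit_le_one hf)
  have hmul : ∀ n, Tendsto (fun m => approxUnit f n * approxUnit f m) atTop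
      (nhds (approxUnit f n)) := fun n => by
    obtain ⟨k, -, hk⟩ := exists_approxUnit_eq hf n
    rw [hk]
    simpa only [mul_assoc] using (tendsto_mul_approxUnit hf).const_mul k
  have hfixn : ∀ n, δ.toHom (approxUnit f n) = inl C A (approxUnit f n) := fun n =>
    δ.cfc_mem_fixedPoints (IsSelfAdjoint.of_nonneg hf) hfix _
      (continuousOn_id.mul (continuousOn_inv_add hf n))
  have hle : EnvelopingVN.map δ.toHom p = EnvelopingVN.map (inl C A) p := by
    ext ψ
    refine tendsto_nhds_unique (hp (ψ ∘L δ.toHom.toCLM))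
      ((hp (ψ ∘L (inl C A).toCLM)).congr fun n => ?_)
    exact congrArg ψ (hfixn n).symm
  rcases h p (isOpenProjection_of_tendsto (approxUnit_monotone hf) hpos hmul hp)
    (fun ψ _ => hle ▸ le_rfl) with h0 | h1
  · refine hf0 (SeparatingDual.eq_zero_of_forall_dual_eq_zero (R := ℂ) fun φ => ?_)
    have h2 := hp (φ ∘L (ContinuousLinearMap.mul ℂ C).flip f)
    rw [h0] at h2
    exact tendsto_nhds_unique ((φ.continuous.tendsto _).comp (tendsto_approxUnit_mul hf)) h2
  · refine hg0 (SeparatingDual.eq_zero_of_forall_dual_eq_zero (R := ℂ) fun φ => ?_)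
    have h2 := hp (φ ∘L (ContinuousLinearMap.mul ℂ C).flip g)
    have h3 : ∀ n, approxUnit f n * g = 0 := fun n => by
      obtain ⟨k, -, hk⟩ := exists_approxUnit_eq hf n
      rw [hk, mul_assoc, hfg, mul_zero]
    have h4 : p (φ ∘L (ContinuousLinearMap.mul ℂ C).flip g) = φ g := by
      rw [h1]
      change φ (1 * g) = φ g
      rw [one_mul]
    rw [h4] at h2
    refine tendsto_nhds_unique h2 (tendsto_const_nhds.congr fun n => ?_)
    change 0 = φ (approxUnit f n * g)
    rw [h3, map_zero]

end CompactQuantumGroup.Action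
end

noncomputable section

open Filter

namespace EnvelopingVN

variable {C : Type u} [CStarAlgebra C]

theorem exists_vector_eq (p : EnvelopingVN C) (π : HilbertRep C) (η : π.H) :
    ∃ ζ : π.H, ∀ ξ, inner ℂ ξ ζ = p (π.coeff ξ η) := by
  let l : StrongDual ℂ π.H := LinearMap.mkContinuous
    { toFun := fun ξ => star (p (π.coeff ξ η))
      map_add' := fun ξ ξ' => by
        have : π.coeff (ξ + ξ') η = π.coeff ξ η + π.coeff ξ' η := by
          ext a
          exact inner_add_left _ _ _
        rw [this, map_add, star_add]
      map_smul' := fun r ξ => by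
        have : π.coeff (r • ξ) η = star r • π.coeff ξ η := by
          ext a
          exact inner_smul_left _ _ _
        rw [this, map_smul, star_smul, star_star]; rfl }
    (‖p‖ * ‖η‖) fun ξ => by
      refine (norm_star _).trans_le ?_
      have h1 : ‖π.coeff ξ η‖ ≤ ‖ξ‖ * ‖η‖ := by
        refine ContinuousLinearMap.opNorm_le_bound _ (by positivity) fun a => ?_
        refine (norm_inner_le_norm _ _).trans ?_
        have h := (π.toHom a).le_of_opNorm_le (π.norm_toHom_le a) η
        calc ‖ξ‖ * ‖π.toHom a η‖ ≤ ‖ξ‖ * (‖a‖ * ‖η‖) := by gcongr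
          _ = _ := by ring
      calc ‖p (π.coeff ξ η)‖ ≤ ‖p‖ * (‖ξ‖ * ‖η‖) := p.le_of_opNorm_le_of_le le_rfl h1
        _ = _ := by ring
  refine ⟨(InnerProductSpace.toDual ℂ π.H).symm l, fun ξ => ?_⟩
  rw [← inner_conj_symm, InnerProductSpace.toDual_symm_apply]
  exact star_star _

theorem apply_coeff_of_idempotent {p : EnvelopingVN C} (hp : mul p p = p)
    (h : ∀ φ : StrongDual ℂ C, IsPositive φ → p φ = 0 → φ 1 = 0) (π : HilbertRep C) (η : π.H) :
    p (π.coeff η η) = inner ℂ η η := by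
  obtain ⟨ζ, hζ⟩ := exists_vector_eq p π η
  have h1 : ∀ ξ, π.coeff ξ ζ = rightAct p (π.coeff ξ η) := fun ξ => by
    ext a
    rw [rightAct_apply, HilbertRep.coeff_apply]
    have h2 := π.inner_toHom_star_mul ξ ζ (star a) 1
    rw [star_star, mul_one, map_one] at h2
    refine h2.trans ((hζ _).trans (congrArg p ?_))
    ext b
    have h3 := π.inner_toHom_star_mul ξ η (star a) b
    rw [star_star] at h3
    exact h3.symm
  have h2 : ∀ ξ, p (π.coeff ξ ζ) = inner ℂ ξ ζ := fun ξ => by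
    rw [h1, ← mul_apply, hp, hζ]
  have h3 : π.coeff (η - ζ) (η - ζ) = π.coeff (η - ζ) η - π.coeff (η - ζ) ζ := by
    ext a
    rw [HilbertRep.coeff_apply, map_sub, inner_sub_right]
    rfl
  have h4 := h _ (π.isPositive_coeff (η - ζ)) (by rw [h3, map_sub, h2, hζ, sub_self])
  rw [HilbertRep.coeff_apply, map_one] at h4
  have h5 : η = ζ := sub_eq_zero.mp (inner_self_eq_zero.mp h4)
  rw [← hζ η, ← h5]

variable [PartialOrder C] [StarOrderedRing C]

/-- An idempotent that annihilates no nonzero positive functional agrees with the unit on positive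
functionals. -/
theorem apply_eq_of_isPositive {p : EnvelopingVN C} (hp : mul p p = p)
    (h : ∀ φ : StrongDual ℂ C, IsPositive φ → p φ = 0 → φ 1 = 0) {φ : StrongDual ℂ C}
    (hφ : IsPositive φ) : p φ = φ 1 := by
  have h1 := apply_coeff_of_idempotent hp h (HilbertRep.gns hφ.toPositive)
    (HilbertRep.gnsVector hφ.toPositive)
  have h2 : (HilbertRep.gns hφ.toPositive).coeff (HilbertRep.gnsVector hφ.toPositive)
      (HilbertRep.gnsVector hφ.toPositive) = φ := by
    ext a
    exact HilbertRep.inner_gns hφ.toPositive a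
  rw [h2] at h1
  rw [h1, ← hφ.toPositive_apply, ← HilbertRep.inner_gns, map_one (HilbertRep.gns _).toHom]
  rfl

end EnvelopingVN

section Dini

open EnvelopingVN

variable {C : Type u} [CStarAlgebra C]

variable (C) in
/-- The state space, with the weak-* topology. -/
def stateSpace : Set (WeakDual ℂ C) :=
  {φ | IsPositive (WeakDual.toStrongDual φ) ∧ φ 1 = 1 ∧ ‖WeakDual.toStrongDual φ‖ ≤ 1}

theorem isCompact_stateSpace : IsCompact (stateSpace C) := by
  have hball := WeakDual.isCompact_closedBall (0 : StrongDual ℂ C) 1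
  have h1 : IsClosed {φ : WeakDual ℂ C | ∀ a : C, 0 ≤ φ (star a * a)} := by
    rw [Set.ofPred_forall]
    exact isClosed_iInter fun a => isClosed_le continuous_const (WeakDual.eval_continuous _)
  have h2 : IsClosed {φ : WeakDual ℂ C | φ 1 = 1} :=
    isClosed_eq (WeakDual.eval_continuous _) continuous_const
  convert hball.inter_left (h1.inter h2) using 1
  ext φ
  simp only [stateSpace, Set.mem_ofPred_eq, Set.mem_inter_iff, Set.mem_preimage,
    mem_closedBall_zero_iff, and_assoc]
  rfl

variable [PartialOrder C] [StarOrderedRing C]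

theorem le_algebraMap_of_forall_stateSpace {a : C} (ha : IsSelfAdjoint a) {ε : ℝ}
    (h : ∀ φ ∈ stateSpace C, (φ a).re ≤ ε) : a ≤ algebraMap ℝ C ε := by
  rw [← sub_nonneg]
  refine nonneg_of_forall_positive (.sub (.algebraMap C (.all ε)) ha) fun F => ?_
  have hre : ((F a).re : ℂ) = F a := Complex.conj_eq_iff_re.mp (by
    rw [← Complex.star_def, ← map_star, ha.star_eq])
  have h1re : ((F 1).re : ℂ) = F 1 := Complex.conj_eq_iff_re.mp (by
    rw [← Complex.star_def, ← map_star, star_one])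
  have h1 : 0 ≤ F 1 := by
    simpa [PositiveLinearMap.toDual_apply] using F.isPositive_toDual 1
  rw [← h1re, Complex.zero_le_real] at h1
  have hε : F (algebraMap ℝ C ε) = ((ε * (F 1).re : ℝ) : ℂ) := by
    rw [Algebra.algebraMap_eq_smul_one, ← Complex.coe_smul, map_smul, Complex.ofReal_mul, h1re,
      smul_eq_mul]
  rw [map_sub, hε, ← hre, ← Complex.ofReal_sub, Complex.zero_le_real, sub_nonneg]
  rcases h1.eq_or_lt with h0 | hpos
  · have h2 := norm_apply_le_of_positive F a
    rw [← h0, zero_mul, norm_le_zero_iff] at h2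
    rw [h2, ← h0, mul_zero, Complex.zero_re]
  · have h2 := h (StrongDual.toWeakDual (((F 1).re⁻¹ : ℂ) • F.toDual)) ⟨fun b => ?_, ?_, ?_⟩
    · change (((F 1).re⁻¹ : ℂ) * F a).re ≤ ε at h2
      rw [← Complex.ofReal_inv, Complex.re_ofReal_mul, inv_mul_le_iff₀ hpos] at h2
      linarith
    · change 0 ≤ ((F 1).re⁻¹ : ℂ) * F.toDual (star b * b)
      rw [← Complex.ofReal_inv]
      exact mul_nonneg (Complex.zero_le_real.mpr (inv_nonneg.mpr h1)) (F.isPositive_toDual b)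
    · change ((F 1).re⁻¹ : ℂ) * F 1 = 1
      rw [h1re, inv_mul_cancel₀]
      rw [← h1re]
      exact_mod_cast hpos.ne'
    · refine ContinuousLinearMap.opNorm_le_bound _ zero_le_one fun b => ?_
      change ‖((F 1).re⁻¹ : ℂ) * F b‖ ≤ 1 * ‖b‖
      rw [← Complex.ofReal_inv, norm_mul, Complex.norm_real, Real.norm_of_nonneg
        (inv_nonneg.mpr h1), inv_mul_le_iff₀ hpos, one_mul]
      exact norm_apply_le_of_positive F b

/-- Dini's theorem: an increasing net that converges to the unit on every positive functional
converges in norm. -/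
theorem tendsto_one_of_monotone {ι : Type u} [Preorder ι] [IsDirectedOrder ι] [Nonempty ι]
    {x : ι → C} (hx : Monotone x) (h0 : ∀ i, 0 ≤ x i)
    (h : ∀ φ : StrongDual ℂ C, IsPositive φ → Tendsto (fun i => φ (x i)) atTop (nhds (φ 1))) :
    Tendsto x atTop (nhds 1) := by
  have hsa : ∀ i, IsSelfAdjoint (1 - x i) := fun i => (IsSelfAdjoint.one C).sub (.of_nonneg (h0 i))
  have hle : ∀ i, 0 ≤ 1 - x i := fun i => nonneg_of_forall_positive (hsa i) fun F => by
    rw [map_sub, sub_nonneg]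
    exact (F.isPositive_toDual.monotone.comp hx).ge_of_tendsto (h _ F.isPositive_toDual) i
  refine Metric.tendsto_nhds.mpr fun ε hε => ?_
  obtain ⟨s, hs⟩ := isCompact_stateSpace.elim_finite_subcover
    (fun i => {φ : WeakDual ℂ C | (φ (1 - x i)).re < ε / 2})
    (fun i => isOpen_lt (Complex.continuous_re.comp (WeakDual.eval_continuous _)) continuous_const)
    (fun φ hφ => by
      have h1 := h (WeakDual.toStrongDual φ) hφ.1
      have h2 := (Complex.continuous_re.tendsto _).comp (h1.const_sub (φ 1))
      change Tendsto (fun i => (φ 1 - φ (x i)).re) atTop (nhds (φ 1 - φ 1).re) at h2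
      rw [sub_self, Complex.zero_re] at h2
      obtain ⟨i, hi⟩ := (h2.eventually (gt_mem_nhds (half_pos hε))).exists
      refine Set.mem_iUnion.mpr ⟨i, ?_⟩
      rw [Set.mem_ofPred_eq, map_sub]
      exact hi)
  obtain ⟨i, hsi⟩ := s.exists_le
  filter_upwards [eventually_ge_atTop i] with j hj
  have h1 : 1 - x i ≤ algebraMap ℝ C (ε / 2) :=
    le_algebraMap_of_forall_stateSpace (hsa i) fun φ hφ => by
      obtain ⟨k, hk, hφk⟩ := Set.mem_iUnion₂.mp (hs hφ)
      have h3 := hφ.1.monotone (sub_le_sub_left (hx (hsi k hk)) 1)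
      exact (Complex.le_def.mp h3).1.trans (le_of_lt hφk)
  have h2 := (CStarAlgebra.norm_le_iff_le_algebraMap _ (half_pos hε).le (hle j)).mpr
    ((sub_le_sub_left (hx hj) 1).trans h1)
  rw [dist_comm, dist_eq_norm]
  linarith

end Dini
end

noncomputable section

open Filter

namespace CompactQuantumGroup.Action

open EnvelopingVN SpatialTensor

variable {A C : Type u} [CStarAlgebra A] [PartialOrder A] [StarOrderedRing A]
  [CStarAlgebra C] [PartialOrder C] [StarOrderedRing C] {G : CompactQuantumGroup A}

theorem isPositive_comp_sliceRight (h : A →ₚ[ℂ] ℂ) {φ : StrongDual ℂ C} (hφ : IsPositive φ) :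
    IsPositive (φ ∘L (sliceRight h : SpatialTensor C A →L[ℂ] C)) :=
  fun x => hφ.nonneg (sliceRight_nonneg h x)

theorem apply_comp_average_le (δ : G.Action C) {h : A →ₚ[ℂ] ℂ} (h1 : h 1 = 1)
    {p : EnvelopingVN C} (hp : le (map δ.toHom p) (map (inl C A) p)) {φ : StrongDual ℂ C}
    (hφ : IsPositive φ) : p (φ ∘L δ.average h) ≤ p φ := by
  refine (hp _ (isPositive_comp_sliceRight h hφ)).trans_eq (congrArg p ?_)
  ext c
  change φ (sliceRight h (tmul c 1)) = φ c
  rw [sliceRight_tmul, h1, one_smul]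

theorem eq_zero_or_eq_unit_of_isErgodic {δ : G.Action C} (he : δ.IsErgodic)
    (hδ : Function.Injective δ.toHom) {h : A →ₚ[ℂ] ℂ} (hh : G.IsHaarState h)
    (hf : ∀ a, h (star a * a) = 0 → a = 0) {p : EnvelopingVN C} (hp : IsOpenProjection p)
    (hle : le (map δ.toHom p) (map (inl C A) p)) : p = 0 ∨ p = unit C := by
  obtain ⟨hproj, ι, _, _, _, x, hx, h0, hlim⟩ := hp
  refine or_iff_not_imp_left.mpr fun hp0 => ?_
  obtain ⟨i, hi⟩ : ∃ i, x i ≠ 0 := by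
    by_contra! hall
    refine hp0 (ContinuousLinearMap.ext fun φ => tendsto_nhds_unique (hlim φ) ?_)
    simp [hall]
  obtain ⟨μ, hμ⟩ := he.exists_average_eq hh (x i)
  have hμ0 : μ ≠ 0 := by
    rintro rfl
    rw [zero_smul] at hμ
    exact hi (δ.eq_zero_of_average_eq_zero hδ hf (h0 i) hμ)
  have key : ∀ φ : StrongDual ℂ C, IsPositive φ → p φ = 0 → φ 1 = 0 := fun φ hφ hpφ => by
    have h1 := δ.apply_comp_average_le hh.map_one hle hφ
    have hmono : Monotone (φ ∘L δ.average h) := fun a b hab => by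
      have := hφ.nonneg (δ.average_nonneg h (sub_nonneg.mpr hab))
      rwa [map_sub, map_sub, sub_nonneg] at this
    have h2 : φ (δ.average h (x i)) ≤ 0 :=
      ((hmono.comp hx).ge_of_tendsto (hlim _) i).trans (h1.trans_eq hpφ)
    have h3 := le_antisymm h2 (hφ.nonneg (δ.average_nonneg h (h0 i)))
    rw [hμ, map_smul, smul_eq_mul] at h3
    exact (mul_eq_zero.mp h3).resolve_left hμ0
  have hone : Tendsto x atTop (nhds 1) := tendsto_one_of_monotone hx h0 fun φ hφ => by
    rw [← apply_eq_of_isPositive hproj.idempotent key hφ]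
    exact hlim φ
  exact ContinuousLinearMap.ext fun φ =>
    tendsto_nhds_unique (hlim φ) ((φ.continuous.tendsto 1).comp hone)

end CompactQuantumGroup.Action
end

theorem mainTheorem4 {A C : Type u} [CStarAlgebra A] [PartialOrder A] [StarOrderedRing A]
    [CStarAlgebra C] [PartialOrder C] [StarOrderedRing C]
    (G : CompactQuantumGroup A) (h : A →ₚ[ℂ] ℂ) (hHaar : G.IsHaarState h)
    (hfaithful : ∀ a : A, h (star a * a) = 0 → a = 0)
    (δ : G.Action C) (hδ : Function.Injective δ.toHom) (hnd : δ.IsNondegenerate) :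
    List.TFAE [
      δ.IsErgodic,
      ∀ J : Ideal C, IsClosed (J : Set C) → δ.IsInvariant (J : Set C) → J = ⊥ ∨ J = ⊤,
      ∀ B : NonUnitalStarSubalgebra ℂ C, IsClosed (B : Set C) → IsHereditary B →
        δ.IsInvariant (B : Set C) → B = ⊥ ∨ B = ⊤,
      ∀ p : EnvelopingVN C, EnvelopingVN.IsOpenProjection p →
        EnvelopingVN.le (EnvelopingVN.map δ.toHom p)
          (EnvelopingVN.map (SpatialTensor.inl C A) p) →
        p = 0 ∨ p = EnvelopingVN.unit C] := by
  tfae_have 1 → 2 := fun he J hJ hinv =>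
    CompactQuantumGroup.Action.eq_bot_or_eq_top_of_isErgodic he hδ hHaar hfaithful J hJ hinv
  tfae_have 2 → 3 := fun h2 => δ.hereditary_eq_bot_or_eq_top h2
  tfae_have 3 → 1 := fun h3 => δ.isErgodic_of_hereditary h3
  tfae_have 1 → 4 := fun he _ hp hle =>
    CompactQuantumGroup.Action.eq_zero_or_eq_unit_of_isErgodic he hδ hHaar hfaithful hp hle
  tfae_have 4 → 1 := fun h4 => δ.isErgodic_of_isOpenProjection h4
  tfae_finish
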